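/- Let $H=(H_{\mathbb Z},W,F)$ be a torsion-free mixed Hodge structure ($H_{\mathbb Z}$ finitely generated) and let $p$ be an integer such that $\mathrm{gr}^W_{2p-1}H$ is polarizable. Write $W_kH$ for the sub-structure with lattice $H_{\mathbb Z}\cap W_k$, and for a mixed Hodge structure $X$ of weights $<2p$ identify $$\mathrm{Ext}(\mathbb Z(-p),X)=X_{\mathbb C}/(F^p+X_{\mathbb Z}).$$ Put $J^p(H)=\mathrm{Ext}(\mathbb Z(-p),\mathrm{gr}^W_{2p-1}H)$ and $H^{p,p}_{\mathbb Z}=\mathrm{Hom}(\mathbb Z(-p),\mathrm{gr}^W_{2p}H)$, and let $$e^p: H^{p,p}_{\mathbb Z}\to J^p(H)$$ be the extension class map of $0\to \mathrm{gr}^W_{2p-1}H\to W_{2p}H/W_{2p-2}H\to \mathrm{gr}^W_{2p}H\to 0$; it sends a class to the difference between a lift in $F^p$ and an integral lift. Let $W_{2p-2}H\subseteq H'\subseteq W_{2p-1}H$ be the largest sub-structure such that $H'/W_{2p-2}H$ is a polarizable sub-Hodge structure of $\mathrm{gr}^W_{2p-1}H$ purely of type $\{(p-1,p),(p,p-1)\}$,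 and let $H''\subseteq W_{2p}H$ be the preimage of $H^{p,p}_{\mathbb Z}\subseteq \mathrm{gr}^W_{2p}H$. Let $$h^p:\mathrm{Hom}(\mathbb Z(-p),H''/H')\to \mathrm{Ext}(\mathbb Z(-p),H'/W_{2p-2}H)$$ be the extension class map of $0\to H'/W_{2p-2}H\to H''/W_{2p-2}H\to H''/H'\to 0$. Then: 1. The largest sub-structure $H'$ exists, and $J^p(H)$ is a compact complex torus. 2. $h^p$ is a 1-motive over $\mathbb C$: its source is a finitely generated free abelian group and its target is (the group of points of) an abelian variety. 3. The natural map $\mathrm{Ext}(\mathbb Z(-p),H'/W_{2p-2}H)\to J^p(H)$ is injective, and its image $A^p(H)$ is the largest abelian subvariety of $J^p(H)$ of Hodge level one, i.e. the largest among the abelian subvarieties of $J^p(H)$ whose tangent space is contained in $H^{p-1,p}\subseteq \mathrm{gr}^W_{2p-1}H_{\mathbb C}/F^p$. 4. $h^p$ is the restriction of $e^p$ to $A^p(H)$: the natural map $\mathrm{Hom}(\mathbb Z(-p),H''/H')\to H^{p,p}_{\mathbb Z}$ is injective with image $(e^p)^{-1}(A^p(H))$, and under these two inclusions $h^p$ is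 $e^p|_{(e^p)^{-1}(A^p(H))}$. 5. In particular $\ker(h^p)=\ker(e^p)$ as subgroups of $H^{p,p}_{\mathbb Z}$. -/

import Mathlib

open scoped TensorProduct

noncomputable section

namespace HodgeOneMotive

/-! ## Mixed Hodge structures -/

section Structures

variable {L M N : Type*} [AddCommGroup L] [AddCommGroup M] [AddCommGroup N]

/-- Complex conjugation `c ⊗ x ↦ c̄ ⊗ x` on the complexification of an abelian group. -/
def conj (L : Type*) [AddCommGroup L] : ℂ ⊗[ℤ] L →ₗ[ℤ] ℂ ⊗[ℤ] L :=
  LinearMap.rTensor L (starRingEnd ℂ).toAddMonoidHom.toIntLinearMap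

theorem conj_tmul (c : ℂ) (x : L) : conj L (c ⊗ₜ[ℤ] x) = (starRingEnd ℂ c) ⊗ₜ[ℤ] x := rfl

theorem conj_smul (c : ℂ) (x : ℂ ⊗[ℤ] L) :
    conj L (c • x) = (starRingEnd ℂ c) • conj L x := by
  induction x using TensorProduct.induction_on with
  | zero => simp
  | tmul a y => simp [conj_tmul, TensorProduct.smul_tmul']
  | add a b ha hb => simp only [smul_add, map_add, ha, hb]

theorem conj_conj (x : ℂ ⊗[ℤ] L) : conj L (conj L x) = x := by
  induction x using TensorProduct.induction_on with
  | zero => simp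
  | tmul a y => simp [conj_tmul]
  | add a b ha hb => simp only [map_add, ha, hb]

/-- The complex conjugate of a complex subspace (conjugation is an involution, so the preimage
under conjugation is also the image). -/
def conjSub (P : Submodule ℂ (ℂ ⊗[ℤ] L)) : Submodule ℂ (ℂ ⊗[ℤ] L) where
  carrier := {x | conj L x ∈ P}
  add_mem' := by
    intro a b ha hb
    simpa using P.add_mem ha hb
  zero_mem' := by simp
  smul_mem' := by
    intro c x hx
    simpa [conj_smul] using P.smul_mem (starRingEnd ℂ c) hx

/-- The data `(H_ℤ, W, F)`, with `H_ℤ = L`: an increasing filtration `W` of `L ⊗ ℚ` and a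
decreasing filtration `F` of `L ⊗ ℂ`. The axioms of a mixed Hodge structure are in `IsMHS`. -/
structure BifilteredLattice (L : Type*) [AddCommGroup L] where
  W : ℤ → Submodule ℚ (ℚ ⊗[ℤ] L)
  F : ℤ → Submodule ℂ (ℂ ⊗[ℤ] L)
  W_mono : Monotone W
  F_anti : Antitone F

/-- The filtration step induced on the sub-quotient `A / (A ∩ B)` by a subspace `P` of `L ⊗ R`:
intersect with `A ⊗ R`, then project. -/
def inducedStep (R : Type*) [CommRing R] (A B : Submodule ℤ L) (P : Submodule R (R ⊗[ℤ] L)) :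
    Submodule R (R ⊗[ℤ] (A ⧸ B.submoduleOf A)) :=
  (P.comap (A.subtype.baseChange R)).map ((B.submoduleOf A).mkQ.baseChange R)

namespace BifilteredLattice

/-- The sub-quotient `A / B` (for sublattices `B ≤ A` of `H_ℤ`) with the induced filtrations. -/
def subquot (H : BifilteredLattice L) (A B : Submodule ℤ L) :
    BifilteredLattice (A ⧸ B.submoduleOf A) where
  W k := inducedStep ℚ A B (H.W k)
  F k := inducedStep ℂ A B (H.F k)
  W_mono := fun _ _ h => Submodule.map_mono (Submodule.comap_mono (H.W_mono h))
  F_anti := fun _ _ h => Submodule.map_mono (Submodule.comap_mono (H.F_anti h))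

/-- The lattice of `W_k H`: the intersection of `H_ℤ` with `W_k`. -/
def WZ (H : BifilteredLattice L) (k : ℤ) : Submodule ℤ L :=
  ((H.W k).restrictScalars ℤ).comap (TensorProduct.mk ℤ ℚ L 1)

theorem WZ_mono (H : BifilteredLattice L) : Monotone H.WZ :=
  fun _ _ h _ hx => H.W_mono h hx

/-- The graded piece `gr^W_k H = W_k H / W_{k-1} H`. -/
abbrev gr (H : BifilteredLattice L) (k : ℤ) :
    BifilteredLattice (H.WZ k ⧸ (H.WZ (k - 1)).submoduleOf (H.WZ k)) :=
  H.subquot (H.WZ k) (H.WZ (k - 1))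

/-- `F` and its complex conjugate are `n`-opposed: `H_ℂ = F^r ⊕ conj (F^{n+1-r})` for all `r`,
i.e. `F` is the Hodge filtration of a pure Hodge structure of weight `n`. -/
def IsOpposed (H : BifilteredLattice L) (n : ℤ) : Prop :=
  ∀ r : ℤ, IsCompl (H.F r) (conjSub (H.F (n + 1 - r)))

/-- `(H_ℤ, W, F)` is a mixed Hodge structure (on a finitely generated group): `W` and `F` are
finite filtrations, and each `gr^W_n` is a pure Hodge structure of weight `n`. -/
structure IsMHS (H : BifilteredLattice L) : Prop where
  W_bot : ∃ k, H.W k = ⊥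
  W_top : ∃ k, H.W k = ⊤
  F_top : ∃ k, H.F k = ⊤
  F_bot : ∃ k, H.F k = ⊥
  opposed : ∀ n, (H.gr n).IsOpposed n

/-- The Hodge component `H^{r,s} = F^r ∩ conj (F^s)` of a pure Hodge structure of weight `r + s`. -/
def hodgePiece (H : BifilteredLattice L) (r s : ℤ) : Submodule ℂ (ℂ ⊗[ℤ] L) :=
  H.F r ⊓ conjSub (H.F s)

/-- A pure Hodge structure of weight `n` is polarizable: there is an integral bilinear form `S`,
`(-1)^n`-symmetric, with `S(F^r, F^{n+1-r}) = 0`, and `i^{r-s} S(x, x̄) > 0` for nonzero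
`x ∈ H^{r,s}`. -/
def IsPolarizable (H : BifilteredLattice L) (n : ℤ) : Prop :=
  ∃ S : LinearMap.BilinForm ℤ L,
    (∀ x y, S y x = (Int.negOnePow n : ℤ) * S x y) ∧
    (∀ r : ℤ, ∀ x ∈ H.F r, ∀ y ∈ H.F (n + 1 - r),
      LinearMap.BilinForm.baseChange ℂ S x y = 0) ∧
    (∀ r s : ℤ, r + s = n → ∀ x ∈ H.hodgePiece r s, x ≠ 0 →
      ∃ t : ℝ, 0 < t ∧
        Complex.I ^ (r - s) * LinearMap.BilinForm.baseChange ℂ S x (conj L x) = (t : ℂ))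

/-- A pure Hodge structure of weight `2p-1` is purely of type `{(p-1,p), (p,p-1)}`. -/
def IsLevelOne (H : BifilteredLattice L) (p : ℤ) : Prop :=
  H.hodgePiece (p - 1) p ⊔ H.hodgePiece p (p - 1) = ⊤

/-- Morphisms: homomorphisms of the lattices that respect both filtrations. -/
def Hom (X : BifilteredLattice L) (Y : BifilteredLattice M) : Submodule ℤ (L →ₗ[ℤ] M) where
  carrier := {f | (∀ k, ∀ x ∈ X.W k, f.baseChange ℚ x ∈ Y.W k) ∧
    ∀ k, ∀ x ∈ X.F k, f.baseChange ℂ x ∈ Y.F k}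
  add_mem' := by
    rintro f g ⟨hf, hf'⟩ ⟨hg, hg'⟩
    refine ⟨fun k x hx => ?_, fun k x hx => ?_⟩
    · rw [LinearMap.baseChange_add]
      exact (Y.W k).add_mem (hf k x hx) (hg k x hx)
    · rw [LinearMap.baseChange_add]
      exact (Y.F k).add_mem (hf' k x hx) (hg' k x hx)
  zero_mem' := by
    refine ⟨fun k x _ => ?_, fun k x _ => ?_⟩ <;> simp
  smul_mem' := by
    rintro c f ⟨hf, hf'⟩
    refine ⟨fun k x hx => ?_, fun k x hx => ?_⟩
    · rw [LinearMap.baseChange_smul, LinearMap.smul_apply]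
      exact zsmul_mem (hf k x hx) c
    · rw [LinearMap.baseChange_smul, LinearMap.smul_apply]
      exact zsmul_mem (hf' k x hx) c

/-- Composition with a morphism `g : Y ⟶ Z`, as a map `Hom(X, Y) → Hom(X, Z)`. -/
def Hom.postcomp (X : BifilteredLattice L) {Y : BifilteredLattice M} {Z : BifilteredLattice N}
    (g : Hom Y Z) : Hom X Y →ₗ[ℤ] Hom X Z :=
  ((LinearMap.llcomp ℤ L M N g.1).comp (Hom X Y).subtype).codRestrict (Hom X Z) (by
    rintro ⟨f, hf⟩
    refine ⟨fun k x hx => ?_, fun k x hx => ?_⟩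
    · change (g.1.comp f).baseChange ℚ x ∈ _
      rw [LinearMap.baseChange_comp]
      exact g.2.1 k _ (hf.1 k x hx)
    · change (g.1.comp f).baseChange ℂ x ∈ _
      rw [LinearMap.baseChange_comp]
      exact g.2.2 k _ (hf.2 k x hx))

/-- The Tate structure `ℤ(-p)`: rank one, pure of weight `2p` and type `(p,p)`. -/
def tate (p : ℤ) : BifilteredLattice ℤ where
  W k := if 2 * p ≤ k then ⊤ else ⊥
  F k := if k ≤ p then ⊤ else ⊥
  W_mono := by
    intro a b h
    dsimp only
    split_ifs <;> first | exact le_rfl | exact bot_le | (exfalso; omega)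
  F_anti := by
    intro a b h
    dsimp only
    split_ifs <;> first | exact le_rfl | exact bot_le | (exfalso; omega)

theorem Hom.tate_mem_F {p : ℤ} {X : BifilteredLattice L} (φ : Hom (tate p) X) :
    (1 : ℂ) ⊗ₜ[ℤ] φ.1 1 ∈ X.F p := by
  have h := φ.2.2 p ((1 : ℂ) ⊗ₜ[ℤ] (1 : ℤ)) (by simp [tate])
  simpa using h

/-! ## The groups `Ext(ℤ(-p), X)` and extension class maps -/

/-- The complex vector space `X_ℂ / F^p`. -/
abbrev TangentJ (X : BifilteredLattice L) (p : ℤ) : Type _ := (ℂ ⊗[ℤ] L) ⧸ X.F p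

/-- The image of `X_ℤ` in `X_ℂ / F^p`. -/
def latticeJ (X : BifilteredLattice L) (p : ℤ) : Submodule ℤ (X.TangentJ p) :=
  LinearMap.range (((X.F p).mkQ.restrictScalars ℤ).comp (TensorProduct.mk ℤ ℂ L 1))

/-- `J^p(X) = X_ℂ / (F^p + X_ℤ)`, written as the quotient of `X_ℂ / F^p` by the image of `X_ℤ`.
If all weights of `X` are `< 2p`, this is `Ext(ℤ(-p), X)` in mixed Hodge structures. -/
abbrev J (X : BifilteredLattice L) (p : ℤ) : Type _ := X.TangentJ p ⧸ X.latticeJ p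

/-- The projection `X_ℂ → J^p(X)`. -/
def toJ (X : BifilteredLattice L) (p : ℤ) : ℂ ⊗[ℤ] L →ₗ[ℤ] X.J p :=
  (X.latticeJ p).mkQ.comp ((X.F p).mkQ.restrictScalars ℤ)

theorem toJ_of_mem_F (X : BifilteredLattice L) (p : ℤ) {x : ℂ ⊗[ℤ] L} (hx : x ∈ X.F p) :
    X.toJ p x = 0 := by
  have : (X.F p).mkQ x = 0 := by simpa using hx
  simp only [toJ, LinearMap.comp_apply, LinearMap.restrictScalars_apply, this, map_zero]

theorem toJ_int (X : BifilteredLattice L) (p : ℤ) (x : L) :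
    X.toJ p ((1 : ℂ) ⊗ₜ[ℤ] x) = 0 := by
  simp only [toJ, LinearMap.comp_apply, Submodule.mkQ_apply]
  rw [Submodule.Quotient.mk_eq_zero]
  exact ⟨x, rfl⟩

/-- Functoriality: a morphism `f : X ⟶ Y` induces `X_ℂ / F^p → Y_ℂ / F^p`. -/
def tangentMap {X : BifilteredLattice L} {Y : BifilteredLattice M} (p : ℤ) (f : Hom X Y) :
    X.TangentJ p →ₗ[ℂ] Y.TangentJ p :=
  (X.F p).mapQ (Y.F p) (f.1.baseChange ℂ) (fun x hx => f.2.2 p x hx)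

/-- Functoriality: a morphism `f : X ⟶ Y` induces `Ext(ℤ(-p), X) → Ext(ℤ(-p), Y)`. -/
def mapJ {X : BifilteredLattice L} {Y : BifilteredLattice M} (p : ℤ) (f : Hom X Y) :
    X.J p →ₗ[ℤ] Y.J p :=
  (X.latticeJ p).mapQ (Y.latticeJ p) ((tangentMap p f).restrictScalars ℤ) (by
    rintro _ ⟨x, rfl⟩
    refine ⟨f.1 x, ?_⟩
    change (Y.F p).mkQ ((1 : ℂ) ⊗ₜ[ℤ] f.1 x) =
      (Y.F p).mkQ (f.1.baseChange ℂ ((1 : ℂ) ⊗ₜ[ℤ] x))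
    rw [LinearMap.baseChange_tmul])

/-- A short exact sequence `0 → X → Y → Z → 0`: exact on lattices, with `X` and `Z` carrying the
filtrations induced from `Y`. -/
structure ShortExact (X : BifilteredLattice L) (Y : BifilteredLattice M)
    (Z : BifilteredLattice N) where
  i : Hom X Y
  q : Hom Y Z
  injective : Function.Injective i.1
  exact : Function.Exact i.1 q.1
  surjective : Function.Surjective q.1
  W_i : ∀ k, X.W k = (Y.W k).comap (i.1.baseChange ℚ)
  F_i : ∀ k, X.F k = (Y.F k).comap (i.1.baseChange ℂ)
  W_q : ∀ k, Z.W k = (Y.W k).map (q.1.baseChange ℚ)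
  F_q : ∀ k, Z.F k = (Y.F k).map (q.1.baseChange ℂ)

namespace ShortExact

variable {X : BifilteredLattice L} {Y : BifilteredLattice M} {Z : BifilteredLattice N}

/-- For `z ∈ Z_ℤ`, lift `z` to `y ∈ Y_ℤ` and to `f ∈ F^p Y_ℂ`; the difference `f - y` comes from
an element `a` of `X_ℂ`. -/
def IsLift (s : ShortExact X Y Z) (p : ℤ) (z : N) (y : M) (f : ℂ ⊗[ℤ] M) (a : ℂ ⊗[ℤ] L) : Prop :=
  s.q.1 y = z ∧ f ∈ Y.F p ∧ s.q.1.baseChange ℂ f = (1 : ℂ) ⊗ₜ[ℤ] z ∧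
    s.i.1.baseChange ℂ a = f - (1 : ℂ) ⊗ₜ[ℤ] y

theorem exists_isLift (s : ShortExact X Y Z) {p : ℤ} {z : N} (hz : (1 : ℂ) ⊗ₜ[ℤ] z ∈ Z.F p) :
    ∃ y f a, s.IsLift p z y f a := by
  obtain ⟨y, hy⟩ := s.surjective z
  rw [s.F_q p] at hz
  obtain ⟨f, hf, hfz⟩ := hz
  have hex : Function.Exact (s.i.1.lTensor ℂ) (s.q.1.lTensor ℂ) :=
    lTensor_exact ℂ s.exact s.surjective
  have h0 : s.q.1.lTensor ℂ (f - (1 : ℂ) ⊗ₜ[ℤ] y) = 0 := by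
    have h1 : s.q.1.lTensor ℂ f = (1 : ℂ) ⊗ₜ[ℤ] z := hfz
    rw [map_sub, h1, LinearMap.lTensor_tmul, hy, sub_self]
  obtain ⟨a, ha⟩ := (hex _).1 h0
  exact ⟨y, f, a, hy, hf, hfz, ha⟩

theorem isLift_unique (s : ShortExact X Y Z) {p : ℤ} {z : N} {y y' : M} {f f' : ℂ ⊗[ℤ] M}
    {a a' : ℂ ⊗[ℤ] L} (h : s.IsLift p z y f a) (h' : s.IsLift p z y' f' a') :
    X.toJ p a = X.toJ p a' := by
  obtain ⟨hy, hf, -, ha⟩ := h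
  obtain ⟨hy', hf', -, ha'⟩ := h'
  obtain ⟨x, hx⟩ := (s.exact (y - y')).1 (by rw [map_sub, hy, hy', sub_self])
  have hmem : a - a' + (1 : ℂ) ⊗ₜ[ℤ] x ∈ X.F p := by
    rw [s.F_i p, Submodule.mem_comap, map_add, map_sub, ha, ha', LinearMap.baseChange_tmul, hx,
      TensorProduct.tmul_sub]
    have : f - (1 : ℂ) ⊗ₜ[ℤ] y - (f' - (1 : ℂ) ⊗ₜ[ℤ] y') +
        ((1 : ℂ) ⊗ₜ[ℤ] y - (1 : ℂ) ⊗ₜ[ℤ] y') = f - f' := by abel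
    rw [this]
    exact (Y.F p).sub_mem hf hf'
  have h2 := X.toJ_of_mem_F p hmem
  rw [map_add, toJ_int, add_zero, map_sub, sub_eq_zero] at h2
  exact h2

theorem IsLift.add {s : ShortExact X Y Z} {p : ℤ} {z z' : N} {y y' : M} {f f' : ℂ ⊗[ℤ] M}
    {a a' : ℂ ⊗[ℤ] L} (h : s.IsLift p z y f a) (h' : s.IsLift p z' y' f' a') :
    s.IsLift p (z + z') (y + y') (f + f') (a + a') := by
  obtain ⟨h1, h2, h3, h4⟩ := h
  obtain ⟨h1', h2', h3', h4'⟩ := h'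
  refine ⟨by rw [map_add, h1, h1'], (Y.F p).add_mem h2 h2', ?_, ?_⟩
  · rw [map_add, h3, h3', TensorProduct.tmul_add]
  · rw [map_add, h4, h4', TensorProduct.tmul_add]
    abel

/-- The element `a` of `IsLift`, for some choice of lifts. -/
def classRep (s : ShortExact X Y Z) (p : ℤ) (φ : Hom (tate p) Z) : ℂ ⊗[ℤ] L :=
  (s.exists_isLift (Hom.tate_mem_F φ)).choose_spec.choose_spec.choose

theorem classRep_spec (s : ShortExact X Y Z) (p : ℤ) (φ : Hom (tate p) Z) :
    ∃ y f, s.IsLift p (φ.1 1) y f (s.classRep p φ) :=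
  ⟨_, _, (s.exists_isLift (Hom.tate_mem_F φ)).choose_spec.choose_spec.choose_spec⟩

/-- The extension class map (connecting homomorphism) `Hom(ℤ(-p), Z) → Ext(ℤ(-p), X)` of
`0 → X → Y → Z → 0`, for weights `≤ 2p` on `Y` and `< 2p` on `X`: the class of the pulled back
extension of `ℤ(-p)` by `X` is the difference between a Hodge lift and an integral lift. -/
def extClass (s : ShortExact X Y Z) (p : ℤ) : Hom (tate p) Z →ₗ[ℤ] X.J p :=
  AddMonoidHom.toIntLinearMap
    { toFun := fun φ => X.toJ p (s.classRep p φ)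
      map_zero' := by
        obtain ⟨y, f, h⟩ := s.classRep_spec p 0
        have h0 : s.IsLift p ((0 : Hom (tate p) Z).1 1) 0 0 0 := by
          refine ⟨?_, (Y.F p).zero_mem, ?_, ?_⟩ <;> simp
        rw [s.isLift_unique h h0, map_zero]
      map_add' := by
        intro φ ψ
        obtain ⟨y, f, h⟩ := s.classRep_spec p (φ + ψ)
        obtain ⟨y1, f1, h1⟩ := s.classRep_spec p φ
        obtain ⟨y2, f2, h2⟩ := s.classRep_spec p ψ
        rw [← map_add]
        exact s.isLift_unique h (h1.add h2) }

theorem extClass_eq (s : ShortExact X Y Z) {p : ℤ} (φ : Hom (tate p) Z) {y : M} {f : ℂ ⊗[ℤ] M}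
    {a : ℂ ⊗[ℤ] L} (h : s.IsLift p (φ.1 1) y f a) : s.extClass p φ = X.toJ p a := by
  obtain ⟨y', f', h'⟩ := s.classRep_spec p φ
  exact s.isLift_unique h' h

end ShortExact

/-! ## Natural maps between sub-quotients -/

/-- The homomorphism `A / B → A' / B'` for `A ≤ A'`, `B ≤ B'`. -/
def subquotLin {A B A' B' : Submodule ℤ L} (hA : A ≤ A') (hB : B ≤ B') :
    (A ⧸ B.submoduleOf A) →ₗ[ℤ] (A' ⧸ B'.submoduleOf A') :=
  (B.submoduleOf A).mapQ (B'.submoduleOf A') (Submodule.inclusion hA) (fun _ hx => hB hx)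

theorem subquotLin_mkQ {A B A' B' : Submodule ℤ L} (hA : A ≤ A') (hB : B ≤ B')
    (R : Type*) [CommRing R] (x : R ⊗[ℤ] A) :
    (subquotLin hA hB).baseChange R ((B.submoduleOf A).mkQ.baseChange R x) =
      (B'.submoduleOf A').mkQ.baseChange R ((Submodule.inclusion hA).baseChange R x) := by
  induction x using TensorProduct.induction_on with
  | zero => simp
  | tmul a y => rfl
  | add a b ha hb => simp only [map_add, ha, hb]

theorem inclusion_subtype {A A' : Submodule ℤ L} (hA : A ≤ A')
    (R : Type*) [CommRing R] (x : R ⊗[ℤ] A) :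
    A'.subtype.baseChange R ((Submodule.inclusion hA).baseChange R x) =
      A.subtype.baseChange R x := by
  induction x using TensorProduct.induction_on with
  | zero => simp
  | tmul a y => simp
  | add a b ha hb => simp only [map_add, ha, hb]

theorem subquotLin_mem {A B A' B' : Submodule ℤ L} (hA : A ≤ A') (hB : B ≤ B')
    (R : Type*) [CommRing R] (P : Submodule R (R ⊗[ℤ] L)) (x : R ⊗[ℤ] (A ⧸ B.submoduleOf A))
    (hx : x ∈ inducedStep R A B P) :
    (subquotLin hA hB).baseChange R x ∈ inducedStep R A' B' P := by
  obtain ⟨y, hy, rfl⟩ := hx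
  rw [subquotLin_mkQ]
  refine Submodule.mem_map_of_mem ?_
  change A'.subtype.baseChange R _ ∈ P
  rw [inclusion_subtype]
  exact hy

/-- The natural morphism `A / B ⟶ A' / B'` for `A ≤ A'`, `B ≤ B'`. -/
def subquotMap (H : BifilteredLattice L) {A B A' B' : Submodule ℤ L} (hA : A ≤ A') (hB : B ≤ B') :
    Hom (H.subquot A B) (H.subquot A' B') :=
  ⟨subquotLin hA hB, fun k x hx => subquotLin_mem hA hB ℚ (H.W k) x hx,
    fun k x hx => subquotLin_mem hA hB ℂ (H.F k) x hx⟩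

theorem inducedStep_comap {B A C : Submodule ℤ L} (hBA : B ≤ A) (hAC : A ≤ C)
    (R : Type*) [CommRing R] (P : Submodule R (R ⊗[ℤ] L)) :
    inducedStep R A B P =
      (inducedStep R C B P).comap ((subquotLin hAC (le_refl B)).baseChange R) := by
  refine le_antisymm (fun x hx => subquotLin_mem hAC le_rfl R P x hx) ?_
  intro x hx
  have hsurj : Function.Surjective ((B.submoduleOf A).mkQ.lTensor R) :=
    LinearMap.lTensor_surjective R (Submodule.mkQ_surjective _)
  obtain ⟨a, rfl⟩ := hsurj x
  change (subquotLin hAC (le_refl B)).baseChange R ((B.submoduleOf A).mkQ.baseChange R a) ∈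
    inducedStep R C B P at hx
  rw [subquotLin_mkQ] at hx
  obtain ⟨f, hf, hfa⟩ := hx
  have hex : Function.Exact ((B.submoduleOf C).subtype.lTensor R)
      ((B.submoduleOf C).mkQ.lTensor R) :=
    lTensor_exact R (LinearMap.exact_subtype_mkQ _) (Submodule.mkQ_surjective _)
  have h0 : (B.submoduleOf C).mkQ.lTensor R
      ((Submodule.inclusion hAC).baseChange R a - f) = 0 := by
    rw [map_sub, sub_eq_zero]
    exact hfa.symm
  obtain ⟨b, hb⟩ := (hex _).1 h0
  let j : B.submoduleOf C →ₗ[ℤ] B.submoduleOf A :=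
    { toFun := fun t => ⟨⟨t.1.1, hBA t.2⟩, t.2⟩
      map_add' := fun _ _ => rfl
      map_smul' := fun _ _ => rfl }
  have hj : (Submodule.inclusion hAC).comp ((B.submoduleOf A).subtype.comp j) =
      (B.submoduleOf C).subtype := rfl
  let b' : R ⊗[ℤ] A := ((B.submoduleOf A).subtype.comp j).baseChange R b
  have hb' : (Submodule.inclusion hAC).baseChange R b' =
      (Submodule.inclusion hAC).baseChange R a - f := by
    rw [← hb, ← hj]
    change _ = ((Submodule.inclusion hAC).comp ((B.submoduleOf A).subtype.comp j)).baseChange R b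
    rw [LinearMap.baseChange_comp]
    rfl
  refine ⟨a - b', ?_, ?_⟩
  · change A.subtype.baseChange R (a - b') ∈ P
    rw [← inclusion_subtype hAC, map_sub, hb', sub_sub_cancel]
    exact hf
  · have hz : (B.submoduleOf A).mkQ.comp ((B.submoduleOf A).subtype.comp j) = 0 := by
      ext t
      simp
    have hz' : (B.submoduleOf A).mkQ.baseChange R b' = 0 := by
      change ((B.submoduleOf A).mkQ.baseChange R ∘ₗ
        ((B.submoduleOf A).subtype.comp j).baseChange R) b = 0
      rw [← LinearMap.baseChange_comp, hz, LinearMap.baseChange_zero, LinearMap.zero_apply]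
    rw [map_sub, hz', sub_zero]
    rfl

theorem inducedStep_map {B A C : Submodule ℤ L} (hBA : B ≤ A)
    (R : Type*) [CommRing R] (P : Submodule R (R ⊗[ℤ] L)) :
    inducedStep R C A P =
      (inducedStep R C B P).map ((subquotLin (le_refl C) hBA).baseChange R) := by
  have h : (Submodule.inclusion (le_refl C)).baseChange R = LinearMap.id := by
    have : Submodule.inclusion (le_refl C) = LinearMap.id := rfl
    rw [this, LinearMap.baseChange_id]
  refine le_antisymm ?_ ?_
  · rintro _ ⟨c, hc, rfl⟩
    refine ⟨_, Submodule.mem_map_of_mem hc, ?_⟩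
    rw [subquotLin_mkQ, h, LinearMap.id_apply]
  · rintro _ ⟨_, hx, rfl⟩
    exact subquotLin_mem le_rfl hBA R P _ hx

/-- The extension `0 → A / B → C / B → C / A → 0` attached to `B ≤ A ≤ C`. -/
def subquotExact (H : BifilteredLattice L) {B A C : Submodule ℤ L} (hBA : B ≤ A) (hAC : A ≤ C) :
    ShortExact (H.subquot A B) (H.subquot C B) (H.subquot C A) where
  i := H.subquotMap hAC le_rfl
  q := H.subquotMap le_rfl hBA
  injective := by
    rw [← LinearMap.ker_eq_bot, eq_bot_iff]
    intro x hx
    obtain ⟨a, rfl⟩ := Submodule.mkQ_surjective _ x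
    have : (B.submoduleOf C).mkQ (Submodule.inclusion hAC a) = 0 := hx
    rw [Submodule.mkQ_apply, Submodule.Quotient.mk_eq_zero] at this
    rw [Submodule.mem_bot, Submodule.mkQ_apply, Submodule.Quotient.mk_eq_zero]
    exact this
  exact := by
    intro x
    obtain ⟨c, rfl⟩ := Submodule.mkQ_surjective _ x
    constructor
    · intro h
      have h' : (A.submoduleOf C).mkQ c = 0 := h
      rw [Submodule.mkQ_apply, Submodule.Quotient.mk_eq_zero] at h'
      exact ⟨(B.submoduleOf A).mkQ ⟨c.1, h'⟩, rfl⟩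
    · rintro ⟨y, hy⟩
      obtain ⟨a, rfl⟩ := Submodule.mkQ_surjective _ y
      rw [← hy]
      change (A.submoduleOf C).mkQ (Submodule.inclusion hAC a) = 0
      rw [Submodule.mkQ_apply, Submodule.Quotient.mk_eq_zero]
      exact a.2
  surjective := by
    intro x
    obtain ⟨c, rfl⟩ := Submodule.mkQ_surjective _ x
    exact ⟨(B.submoduleOf C).mkQ c, rfl⟩
  W_i k := inducedStep_comap hBA hAC ℚ (H.W k)
  F_i k := inducedStep_comap hBA hAC ℂ (H.F k)
  W_q k := inducedStep_map hBA ℚ (H.W k)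
  F_q k := inducedStep_map hBA ℂ (H.F k)

/-! ## The sub-structures `H' ⊆ H''` and the maps `e^p`, `h^p` -/

/-- `gr^W_{2p-1} H = W_{2p-1} H / W_{2p-2} H`. -/
abbrev grOdd (H : BifilteredLattice L) (p : ℤ) :
    BifilteredLattice (H.WZ (2 * p - 1) ⧸ (H.WZ (2 * p - 2)).submoduleOf (H.WZ (2 * p - 1))) :=
  H.subquot (H.WZ (2 * p - 1)) (H.WZ (2 * p - 2))

/-- `gr^W_{2p} H = W_{2p} H / W_{2p-1} H`. -/
abbrev grEven (H : BifilteredLattice L) (p : ℤ) :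
    BifilteredLattice (H.WZ (2 * p) ⧸ (H.WZ (2 * p - 1)).submoduleOf (H.WZ (2 * p))) :=
  H.subquot (H.WZ (2 * p)) (H.WZ (2 * p - 1))

theorem WZ_step₁ (H : BifilteredLattice L) (p : ℤ) : H.WZ (2 * p - 2) ≤ H.WZ (2 * p - 1) :=
  H.WZ_mono (by omega)

theorem WZ_step₂ (H : BifilteredLattice L) (p : ℤ) : H.WZ (2 * p - 1) ≤ H.WZ (2 * p) :=
  H.WZ_mono (by omega)

/-- The sublattices `W_{2p-2} H ≤ K ≤ W_{2p-1} H` such that `K / W_{2p-2} H` is a sub-Hodge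
structure of `gr^W_{2p-1} H` which is polarizable and purely of type `{(p-1,p), (p,p-1)}`. -/
def levelOneSubs (H : BifilteredLattice L) (p : ℤ) : Set (Submodule ℤ L) :=
  {K | H.WZ (2 * p - 2) ≤ K ∧ K ≤ H.WZ (2 * p - 1) ∧
    (H.subquot K (H.WZ (2 * p - 2))).IsOpposed (2 * p - 1) ∧
    (H.subquot K (H.WZ (2 * p - 2))).IsPolarizable (2 * p - 1) ∧
    (H.subquot K (H.WZ (2 * p - 2))).IsLevelOne p}

/-- The (lattice of the) sub-structure `H'` of `W_{2p-1} H`: the sum of all members of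
`levelOneSubs`, so that it is the largest one as soon as there is a largest one. -/
def Hprime (H : BifilteredLattice L) (p : ℤ) : Submodule ℤ L :=
  H.WZ (2 * p - 2) ⊔ sSup (H.levelOneSubs p)

/-- The (lattice of the) sub-structure `H''` of `W_{2p} H`: the preimage of the group
`H_ℤ^{p,p}` of integral `(p,p)`-classes in `gr^W_{2p} H`. -/
def Hsecond (H : BifilteredLattice L) (p : ℤ) : Submodule ℤ L :=
  ((((H.grEven p).F p).restrictScalars ℤ).comap
    ((TensorProduct.mk ℤ ℂ _ 1).comp
      ((H.WZ (2 * p - 1)).submoduleOf (H.WZ (2 * p))).mkQ)).map (H.WZ (2 * p)).subtype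

theorem WZ_le_Hprime (H : BifilteredLattice L) (p : ℤ) : H.WZ (2 * p - 2) ≤ H.Hprime p :=
  le_sup_left

theorem Hprime_le (H : BifilteredLattice L) (p : ℤ) : H.Hprime p ≤ H.WZ (2 * p - 1) :=
  sup_le (H.WZ_step₁ p) (sSup_le fun _ hK => hK.2.1)

theorem Hsecond_le (H : BifilteredLattice L) (p : ℤ) : H.Hsecond p ≤ H.WZ (2 * p) :=
  Submodule.map_subtype_le _ _

theorem le_Hsecond (H : BifilteredLattice L) (p : ℤ) : H.WZ (2 * p - 1) ≤ H.Hsecond p := by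
  intro x hx
  refine ⟨⟨x, H.WZ_step₂ p hx⟩, ?_, rfl⟩
  have h0 : ((H.WZ (2 * p - 1)).submoduleOf (H.WZ (2 * p))).mkQ ⟨x, H.WZ_step₂ p hx⟩ = 0 := by
    rw [Submodule.mkQ_apply, Submodule.Quotient.mk_eq_zero]
    exact hx
  change TensorProduct.mk ℤ ℂ _ 1 (((H.WZ (2 * p - 1)).submoduleOf (H.WZ (2 * p))).mkQ
    ⟨x, H.WZ_step₂ p hx⟩) ∈ (H.grEven p).F p
  rw [h0, map_zero]
  exact Submodule.zero_mem _

theorem Hprime_le_Hsecond (H : BifilteredLattice L) (p : ℤ) : H.Hprime p ≤ H.Hsecond p :=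
  (H.Hprime_le p).trans (H.le_Hsecond p)

/-- `e^p : H_ℤ^{p,p} = Hom(ℤ(-p), gr^W_{2p} H) → Ext(ℤ(-p), gr^W_{2p-1} H) = J^p(H)`, the
extension class map of `0 → gr^W_{2p-1} H → W_{2p} H / W_{2p-2} H → gr^W_{2p} H → 0`. -/
def eMap (H : BifilteredLattice L) (p : ℤ) :
    Hom (tate p) (H.grEven p) →ₗ[ℤ] (H.grOdd p).J p :=
  (H.subquotExact (H.WZ_step₁ p) (H.WZ_step₂ p)).extClass p

/-- `H' / W_{2p-2} H`. -/
abbrev abelianPart (H : BifilteredLattice L) (p : ℤ) :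
    BifilteredLattice (H.Hprime p ⧸ (H.WZ (2 * p - 2)).submoduleOf (H.Hprime p)) :=
  H.subquot (H.Hprime p) (H.WZ (2 * p - 2))

/-- `H'' / H'`. -/
abbrev cyclePart (H : BifilteredLattice L) (p : ℤ) :
    BifilteredLattice (H.Hsecond p ⧸ (H.Hprime p).submoduleOf (H.Hsecond p)) :=
  H.subquot (H.Hsecond p) (H.Hprime p)

/-- `h^p : Hom(ℤ(-p), H''/H') → Ext(ℤ(-p), H'/W_{2p-2} H)`, the extension class map of
`0 → H'/W_{2p-2} H → H''/W_{2p-2} H → H''/H' → 0`. -/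
def hMap (H : BifilteredLattice L) (p : ℤ) :
    Hom (tate p) (H.cyclePart p) →ₗ[ℤ] (H.abelianPart p).J p :=
  (H.subquotExact (H.WZ_le_Hprime p) (H.Hprime_le_Hsecond p)).extClass p

/-- The map `Hom(ℤ(-p), H''/H') → Hom(ℤ(-p), gr^W_{2p} H) = H_ℤ^{p,p}` induced by the natural
morphism `H''/H' ⟶ W_{2p} H / W_{2p-1} H`. -/
def cycleMap (H : BifilteredLattice L) (p : ℤ) :
    Hom (tate p) (H.cyclePart p) →ₗ[ℤ] Hom (tate p) (H.grEven p) :=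
  Hom.postcomp (tate p) (H.subquotMap (H.Hsecond_le p) (H.Hprime_le p))

/-- The map `Ext(ℤ(-p), H'/W_{2p-2} H) → Ext(ℤ(-p), gr^W_{2p-1} H) = J^p(H)` induced by the
inclusion `H'/W_{2p-2} H ⟶ gr^W_{2p-1} H`. -/
def jacobianMap (H : BifilteredLattice L) (p : ℤ) :
    (H.abelianPart p).J p →ₗ[ℤ] (H.grOdd p).J p :=
  mapJ p (H.subquotMap (H.Hprime_le p) le_rfl)

end BifilteredLattice

end Structures

/-! ## Complex tori, abelian varieties and 1-motives over `ℂ` -/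

section Tori

variable {V : Type*} [AddCommGroup V] [Module ℂ V]

/-- `Λ` is a (full) lattice in the complex vector space `V`, i.e. the `ℤ`-span of an `ℝ`-basis;
equivalently `V` is finite-dimensional and `V / Λ` is a complex torus. -/
def IsComplexTorus (Λ : Submodule ℤ V) : Prop :=
  ∃ (n : ℕ) (b : Module.Basis (Fin n) ℝ V), Λ = Submodule.span ℤ (Set.range b)

/-- The complex torus `V / Λ` is an abelian variety: it has a positive definite Riemann form,
i.e. an alternating real form `E`, integral on `Λ`, with `E(iv, iw) = E(v, w)` and `E(iv, v) > 0`
for `v ≠ 0`. -/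
def IsAbelianVariety (Λ : Submodule ℤ V) : Prop :=
  IsComplexTorus Λ ∧
    ∃ E : LinearMap.BilinForm ℝ V,
      (∀ v, E v v = 0) ∧
      (∀ x ∈ Λ, ∀ y ∈ Λ, ∃ m : ℤ, E x y = (m : ℝ)) ∧
      (∀ v w, E (Complex.I • v) (Complex.I • w) = E v w) ∧
      (∀ v, v ≠ 0 → 0 < E (Complex.I • v) v)

/-- The subgroup `B` of the complex torus `V / Λ` is an abelian subvariety with tangent space
`U ⊆ V`: `U ∩ Λ` is a lattice in `U`, the torus `U / (U ∩ Λ)` is an abelian variety, and `B` is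
its image in `V / Λ`. -/
def IsAbelianSubvariety (Λ : Submodule ℤ V) (U : Submodule ℂ V) (B : Submodule ℤ (V ⧸ Λ)) : Prop :=
  IsAbelianVariety (Λ.comap (U.subtype.restrictScalars ℤ)) ∧
    B = (U.restrictScalars ℤ).map Λ.mkQ

/-- `V / Λ` is a semi-abelian variety `G`: there is a subspace `U` of the Lie algebra `V` such
that `U ∩ Λ` is the `ℤ`-span of a `ℂ`-basis of `U` (so that `U / (U ∩ Λ) ≅ (ℂˣ)^m` is an
algebraic torus `T`), and the quotient `G / T = (V / U) / (image of Λ)` is an abelian variety. -/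
def IsSemiabelian (Λ : Submodule ℤ V) : Prop :=
  ∃ U : Submodule ℂ V,
    (∃ (m : ℕ) (b : Module.Basis (Fin m) ℂ U),
      Λ.comap (U.subtype.restrictScalars ℤ) = Submodule.span ℤ (Set.range b)) ∧
    IsAbelianVariety (Λ.map (U.mkQ.restrictScalars ℤ))

/-- A homomorphism `u : M → G = V / Λ` is a 1-motive over `ℂ`: `M` is a finitely generated free
abelian group and `G` is a semi-abelian variety. -/
def IsOneMotive {M : Type*} [AddCommGroup M] {Λ : Submodule ℤ V} (_u : M →ₗ[ℤ] V ⧸ Λ) : Prop :=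
  Module.Finite ℤ M ∧ Module.Free ℤ M ∧ IsSemiabelian Λ

end Tori

namespace BifilteredLattice

/-- The subspace of the tangent space `gr^W_{2p-1} H_ℂ / F^p` of `J^p(H)` that is the image of
the Hodge component `H^{p-1,p}`. -/
def levelOneTangent {L : Type*} [AddCommGroup L] (H : BifilteredLattice L) (p : ℤ) :
    Submodule ℂ ((H.grOdd p).TangentJ p) :=
  ((H.grOdd p).hodgePiece (p - 1) p).map ((H.grOdd p).F p).mkQ

end BifilteredLattice

end HodgeOneMotive

end

/-!
Everything takes place in the pure structure `Y = gr^W_{2p-1} H`, with lattice `Q`, and its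
sublattices. A sublattice `P` underlies a sub-Hodge structure of type `{(p-1,p), (p,p-1)}` exactly
when `P_ℂ` is the sum of its intersections with `H^{p-1,p}` and `H^{p,p-1}`
(`IsLevelOneSub`). This condition can be tested on elements of `P`, passes to arbitrary sums
(`isLevelOneSub_sSup`) and to saturations, so there is a largest such sublattice and it is saturated
(`mem_max_of_tmul_mem`). A polarization of `Y` restricts to each of them, hence the largest one
is `H'/W_{2p-2}` (`Hprime_isGreatest`).

Since `Y_ℂ` is the direct sum of `F^p` and its conjugate, the real points of `Y` map isomorphically
onto `Y_ℂ / F^p`, so that `J^p` is a complex torus (`isComplexTorus_of_isCompl`). In level one a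
polarization is, up to sign, a Riemann form (`isAbelianVariety_of_polarization`).

The remaining assertions rest on one observation (`IsLevelOneSub.mem_baseChange_of_sub_mem`): if an
integral element `x` is congruent modulo `F^p` to an element of `P_ℂ`, it is congruent to
some `u ∈ P_ℂ ∩ H^{p-1,p}`, and then `x = u + ū` lies in `P_ℂ`. With saturation this gives the
injectivity of `Ext(ℤ(-p), H'/W_{2p-2}) → J^p(H)` (`mapJ_injective`) and of
`Hom(ℤ(-p), H''/H') → H_ℤ^{p,p}` (`cycleMap_injective`). An abelian subvariety with tangent
space `U` inside `H^{p-1,p}` comes from a level one sublattice, because `U` is stable under `i` and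
is the real span of its lattice points (`isLevelOneSub_of_torus`). The image of
`Hom(ℤ(-p), H''/H')` is found by adjusting lifts (`mem_range_cycleMap`), and the compatibility of
`h^p` with `e^p` is the naturality of extension classes (`ShortExact.mapJ_extClass`).
-/

noncomputable section

namespace HodgeOneMotive

/-! ### Complex conjugation and base change -/

variable {L M N : Type*} [AddCommGroup L] [AddCommGroup M] [AddCommGroup N]

theorem conj_one_tmul (x : L) : conj L ((1 : ℂ) ⊗ₜ[ℤ] x) = (1 : ℂ) ⊗ₜ[ℤ] x := by
  rw [conj_tmul, map_one]

theorem mem_conjSub {P : Submodule ℂ (ℂ ⊗[ℤ] L)} {x : ℂ ⊗[ℤ] L} :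
    x ∈ conjSub P ↔ conj L x ∈ P := Iff.rfl

theorem conj_baseChange (f : M →ₗ[ℤ] N) (x : ℂ ⊗[ℤ] M) :
    conj N (f.baseChange ℂ x) = f.baseChange ℂ (conj M x) := by
  induction x using TensorProduct.induction_on with
  | zero => simp
  | tmul a y => simp [conj_tmul]
  | add a b ha hb => simp only [map_add, ha, hb]

theorem conj_mem_baseChange (P : Submodule ℤ N) {x : ℂ ⊗[ℤ] N} (hx : x ∈ P.baseChange ℂ) :
    conj N x ∈ P.baseChange ℂ := by
  have h : P.baseChange ℂ ≤ conjSub (P.baseChange ℂ) := by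
    conv_lhs => rw [Submodule.baseChange_eq_span]
    rw [Submodule.span_le]
    rintro _ ⟨y, hy, rfl⟩
    change conj N ((1 : ℂ) ⊗ₜ[ℤ] y) ∈ P.baseChange ℂ
    rw [conj_one_tmul]
    exact Submodule.tmul_mem_baseChange_of_mem _ hy
  exact h hx

/-- If `x` is real, `u` lies in the conjugate of `F` and `x - u ∈ F`, then `x = u + ū`. -/
theorem eq_add_conj {F : Submodule ℂ (ℂ ⊗[ℤ] N)} (h : Disjoint F (conjSub F))
    {x u : ℂ ⊗[ℤ] N} (hx : conj N x = x) (hu : u ∈ conjSub F) (hxu : x - u ∈ F) :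
    x = u + conj N u := by
  have h1 : x - u - conj N u ∈ F := Submodule.sub_mem _ hxu hu
  have h2 : x - u - conj N u ∈ conjSub F := by
    have e : conj N (x - u - conj N u) = x - u - conj N u := by
      rw [map_sub, map_sub, conj_conj, hx]
      abel
    rw [mem_conjSub, e]
    exact h1
  have h3 := Submodule.disjoint_def.1 h _ h1 h2
  rw [sub_sub, sub_eq_zero] at h3
  exact h3

theorem range_baseChange (R : Type*) [CommRing R] (f : M →ₗ[ℤ] N) :
    LinearMap.range (f.baseChange R) = (LinearMap.range f).baseChange R := by
  apply le_antisymm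
  · rintro _ ⟨x, rfl⟩
    induction x using TensorProduct.induction_on with
    | zero => simp
    | tmul a y => exact Submodule.tmul_mem_baseChange_of_mem a ⟨y, rfl⟩
    | add a b ha hb =>
      rw [map_add]
      exact Submodule.add_mem _ ha hb
  · rw [Submodule.baseChange_eq_span, Submodule.span_le]
    rintro _ ⟨_, ⟨y, rfl⟩, rfl⟩
    exact ⟨(1 : R) ⊗ₜ[ℤ] y, by simp⟩

theorem baseChange_injective (R : Type*) [CommRing R] [Module.Flat ℤ R] {f : M →ₗ[ℤ] N}
    (hf : Function.Injective f) : Function.Injective (f.baseChange R) := by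
  rw [LinearMap.baseChange_eq_ltensor]
  exact Module.Flat.lTensor_preserves_injective_linearMap f hf

section Bilinear

theorem baseChange_bilin_conj (S : LinearMap.BilinForm ℤ N) (x y : ℂ ⊗[ℤ] N) :
    LinearMap.BilinForm.baseChange ℂ S (conj N x) (conj N y) =
      starRingEnd ℂ (LinearMap.BilinForm.baseChange ℂ S x y) := by
  induction x using TensorProduct.induction_on with
  | zero => simp
  | add a b ha hb => simp only [map_add, LinearMap.add_apply, ha, hb]
  | tmul a m =>
    induction y using TensorProduct.induction_on with
    | zero => simp
    | add c d hc hd => simp only [map_add, hc, hd]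
    | tmul b n => simp [conj_tmul]

theorem baseChange_bilin_swap (S : LinearMap.BilinForm ℤ N) {ε : ℤ}
    (h : ∀ x y, S y x = ε * S x y) (x y : ℂ ⊗[ℤ] N) :
    LinearMap.BilinForm.baseChange ℂ S y x =
      (ε : ℂ) * LinearMap.BilinForm.baseChange ℂ S x y := by
  induction x using TensorProduct.induction_on with
  | zero => simp
  | add a b ha hb => simp only [map_add, LinearMap.add_apply, ha, hb, mul_add]
  | tmul a m =>
    induction y using TensorProduct.induction_on with
    | zero => simp
    | add c d hc hd => simp only [map_add, LinearMap.add_apply, hc, hd, mul_add]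
    | tmul b n =>
      rw [LinearMap.BilinForm.baseChange_tmul, LinearMap.BilinForm.baseChange_tmul, h m n]
      simp only [zsmul_eq_mul]
      push_cast
      ring

theorem baseChange_bilin_comp (S : LinearMap.BilinForm ℤ N) (f : M →ₗ[ℤ] N)
    (x y : ℂ ⊗[ℤ] M) :
    LinearMap.BilinForm.baseChange ℂ (S.compl₁₂ f f) x y =
      LinearMap.BilinForm.baseChange ℂ S (f.baseChange ℂ x) (f.baseChange ℂ y) := by
  induction x using TensorProduct.induction_on with
  | zero => simp
  | add a b ha hb => simp only [map_add, LinearMap.add_apply, ha, hb]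
  | tmul a m =>
    induction y using TensorProduct.induction_on with
    | zero => simp
    | add c d hc hd => simp only [map_add, hc, hd]
    | tmul b n => simp

end Bilinear

namespace BifilteredLattice

/-! ### Sublattices of level one in a pure structure of weight `2p - 1` -/

/-- A sublattice `P` of a pure Hodge structure of weight `2p - 1` is of level one if its
complexification is the sum of its intersections with `H^{p-1,p}` and `H^{p,p-1}`. This is
equivalent to `P` being a sub-Hodge structure of type `{(p-1,p), (p,p-1)}`. -/
def IsLevelOneSub (Y : BifilteredLattice N) (p : ℤ) (P : Submodule ℤ N) : Prop :=
  P.baseChange ℂ ≤ (P.baseChange ℂ ⊓ Y.hodgePiece (p - 1) p) ⊔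
    (P.baseChange ℂ ⊓ Y.hodgePiece p (p - 1))

/-- The sum of all level one sublattices. -/
def maxLevelOneSub (Y : BifilteredLattice N) (p : ℤ) : Submodule ℤ N :=
  sSup {P | Y.IsLevelOneSub p P}

/-- Being of level one can be tested on integral elements. -/
theorem isLevelOneSub_of_forall {Y : BifilteredLattice N} {p : ℤ} {P : Submodule ℤ N}
    (h : ∀ x ∈ P, (1 : ℂ) ⊗ₜ[ℤ] x ∈ (P.baseChange ℂ ⊓ Y.hodgePiece (p - 1) p) ⊔
      (P.baseChange ℂ ⊓ Y.hodgePiece p (p - 1))) : Y.IsLevelOneSub p P := by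
  unfold IsLevelOneSub
  conv_lhs => rw [Submodule.baseChange_eq_span]
  rw [Submodule.span_le]
  rintro _ ⟨x, hx, rfl⟩
  exact h x hx

theorem isLevelOneSub_sSup {Y : BifilteredLattice N} {p : ℤ} {s : Set (Submodule ℤ N)}
    (hs : ∀ P ∈ s, Y.IsLevelOneSub p P) : Y.IsLevelOneSub p (sSup s) := by
  have key : sSup s ≤ ((((sSup s).baseChange ℂ ⊓ Y.hodgePiece (p - 1) p) ⊔
      ((sSup s).baseChange ℂ ⊓ Y.hodgePiece p (p - 1))).restrictScalars ℤ).comap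
        (TensorProduct.mk ℤ ℂ N 1) := by
    refine sSup_le fun P hP x hx => ?_
    have h1 := hs P hP (Submodule.tmul_mem_baseChange_of_mem (1 : ℂ) hx)
    have h2 : P.baseChange ℂ ≤ (sSup s).baseChange ℂ :=
      Submodule.baseChange_mono ℂ (le_sSup hP)
    exact sup_le_sup (inf_le_inf_right _ h2) (inf_le_inf_right _ h2) h1
  exact isLevelOneSub_of_forall fun x hx => key hx

theorem isLevelOneSub_max (Y : BifilteredLattice N) (p : ℤ) :
    Y.IsLevelOneSub p (Y.maxLevelOneSub p) :=
  isLevelOneSub_sSup fun _ hP => hP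

theorem IsLevelOneSub.le_max {Y : BifilteredLattice N} {p : ℤ} {P : Submodule ℤ N}
    (h : Y.IsLevelOneSub p P) : P ≤ Y.maxLevelOneSub p :=
  le_sSup h

/-- The saturation of a level one sublattice is again of level one, so the largest one is
saturated. -/
theorem mem_max_of_tmul_mem {Y : BifilteredLattice N} {p : ℤ} {x : N}
    (hx : (1 : ℂ) ⊗ₜ[ℤ] x ∈ (Y.maxLevelOneSub p).baseChange ℂ) : x ∈ Y.maxLevelOneSub p := by
  let Q : Submodule ℤ N := (((Y.maxLevelOneSub p).baseChange ℂ).restrictScalars ℤ).comap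
    (TensorProduct.mk ℤ ℂ N 1)
  have hle : Y.maxLevelOneSub p ≤ Q := fun y hy =>
    Submodule.tmul_mem_baseChange_of_mem (1 : ℂ) hy
  have hmono := Submodule.baseChange_mono ℂ hle
  have hQ : Y.IsLevelOneSub p Q := isLevelOneSub_of_forall fun y hy =>
    sup_le_sup (inf_le_inf_right _ hmono) (inf_le_inf_right _ hmono) (isLevelOneSub_max Y p hy)
  exact hQ.le_max hx

/-- In weight `2p - 1` the spaces `F^p` and its conjugate are complementary. -/
theorem IsOpposed.isCompl_middle {Y : BifilteredLattice N} {p : ℤ} (h : Y.IsOpposed (2 * p - 1)) :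
    IsCompl (Y.F p) (conjSub (Y.F p)) := by
  have := h p
  rwa [show 2 * p - 1 + 1 - p = p by ring] at this

/-- A real element congruent modulo `F^p` to an element of the complexification of a
level one sublattice `P` lies itself in that complexification. -/
theorem IsLevelOneSub.mem_baseChange_of_sub_mem {Y : BifilteredLattice N} {p : ℤ}
    (hY : Y.IsOpposed (2 * p - 1)) {P : Submodule ℤ N} (hP : Y.IsLevelOneSub p P)
    {x k : ℂ ⊗[ℤ] N} (hx : conj N x = x) (hk : k ∈ P.baseChange ℂ) (hxk : x - k ∈ Y.F p) :
    x ∈ P.baseChange ℂ := by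
  obtain ⟨u, hu, f, hf, rfl⟩ := Submodule.mem_sup.1 (hP hk)
  have hxu : x - u ∈ Y.F p := by
    have : x - u = x - (u + f) + f := by abel
    rw [this]
    exact Submodule.add_mem _ hxk hf.2.1
  rw [eq_add_conj hY.isCompl_middle.disjoint hx hu.2.2 hxu]
  exact Submodule.add_mem _ hu.1 (conj_mem_baseChange P hu.1)

section StrictSub

variable {X : BifilteredLattice M} {Y : BifilteredLattice N} {f : M →ₗ[ℤ] N}

theorem mem_hodgePiece_iff (hF : ∀ k, X.F k = (Y.F k).comap (f.baseChange ℂ)) (r s : ℤ)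
    (x : ℂ ⊗[ℤ] M) : x ∈ X.hodgePiece r s ↔ f.baseChange ℂ x ∈ Y.hodgePiece r s := by
  simp only [hodgePiece, Submodule.mem_inf, mem_conjSub, hF, Submodule.mem_comap,
    conj_baseChange]

theorem isLevelOneSub_range (hF : ∀ k, X.F k = (Y.F k).comap (f.baseChange ℂ)) {p : ℤ}
    (hX : X.IsLevelOne p) : Y.IsLevelOneSub p (LinearMap.range f) := by
  unfold IsLevelOneSub
  rw [← range_baseChange]
  rintro _ ⟨x, rfl⟩
  have hx : x ∈ X.hodgePiece (p - 1) p ⊔ X.hodgePiece p (p - 1) := by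
    rw [show _ = _ from hX]
    trivial
  obtain ⟨u, hu, v, hv, rfl⟩ := Submodule.mem_sup.1 hx
  rw [map_add]
  exact Submodule.add_mem_sup ⟨⟨u, rfl⟩, (mem_hodgePiece_iff hF _ _ u).1 hu⟩
    ⟨⟨v, rfl⟩, (mem_hodgePiece_iff hF _ _ v).1 hv⟩

theorem isLevelOne_of_range (hf : Function.Injective f)
    (hF : ∀ k, X.F k = (Y.F k).comap (f.baseChange ℂ)) {p : ℤ}
    (hP : Y.IsLevelOneSub p (LinearMap.range f)) : X.IsLevelOne p := by
  unfold IsLevelOne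
  rw [eq_top_iff]
  intro x _
  unfold IsLevelOneSub at hP
  rw [← range_baseChange] at hP
  obtain ⟨_, ⟨⟨u, rfl⟩, hu⟩, _, ⟨⟨v, rfl⟩, hv⟩, huv⟩ := Submodule.mem_sup.1 (hP ⟨x, rfl⟩)
  rw [← map_add] at huv
  rw [← baseChange_injective ℂ hf huv]
  exact Submodule.add_mem_sup ((mem_hodgePiece_iff hF _ _ u).2 hu)
    ((mem_hodgePiece_iff hF _ _ v).2 hv)

/-- A level one sublattice is a sub-Hodge structure: outside the middle degree `F^r` is
everything or zero on it. -/
theorem isOpposed_of_isLevelOne (hf : Function.Injective f)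
    (hF : ∀ k, X.F k = (Y.F k).comap (f.baseChange ℂ)) {p : ℤ}
    (hY : Y.IsOpposed (2 * p - 1)) (hX : X.IsLevelOne p) : X.IsOpposed (2 * p - 1) := by
  have hfC := baseChange_injective ℂ hf
  have htop : ∀ r ≤ p - 1, X.F r = ⊤ := by
    intro r hr
    rw [eq_top_iff, ← show _ = _ from hX]
    refine sup_le (inf_le_left.trans (X.F_anti hr)) (inf_le_left.trans (X.F_anti (by omega)))
  have hconj : ∀ r ≤ p - 1, conjSub (X.F r) = ⊤ := by
    intro r hr
    rw [htop r hr]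
    rfl
  have hdisj : ∀ r, Disjoint (X.F r) (conjSub (X.F (2 * p - 1 + 1 - r))) := by
    intro r
    rw [Submodule.disjoint_def]
    intro x hx hx'
    rw [mem_conjSub] at hx'
    rw [hF, Submodule.mem_comap] at hx hx'
    rw [← conj_baseChange] at hx'
    refine hfC ?_
    rw [map_zero]
    exact Submodule.disjoint_def.1 (hY r).disjoint _ hx hx'
  intro r
  refine ⟨hdisj r, codisjoint_iff.2 ?_⟩
  rcases lt_trichotomy r p with h | rfl | h
  · rw [htop r (by omega), top_sup_eq]
  · rw [eq_top_iff, ← show _ = _ from hX, show 2 * r - 1 + 1 - r = r by ring, sup_comm]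
    exact sup_le_sup inf_le_left inf_le_right
  · rw [hconj _ (by omega), sup_top_eq]

theorem isPolarizable_of_injective (hf : Function.Injective f)
    (hF : ∀ k, X.F k = (Y.F k).comap (f.baseChange ℂ)) {n : ℤ} (hY : Y.IsPolarizable n) :
    X.IsPolarizable n := by
  obtain ⟨S, hS, hS1, hS2⟩ := hY
  refine ⟨S.compl₁₂ f f, fun x y => hS _ _, fun r x hx y hy => ?_, fun r s hrs x hx hx0 => ?_⟩
  · rw [baseChange_bilin_comp]
    rw [hF, Submodule.mem_comap] at hx hy
    exact hS1 r _ hx _ hy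
  · obtain ⟨t, ht, h⟩ := hS2 r s hrs _ ((mem_hodgePiece_iff hF r s x).1 hx)
      (fun h => hx0 (baseChange_injective ℂ hf (h.trans (map_zero _).symm)))
    refine ⟨t, ht, ?_⟩
    rw [baseChange_bilin_comp, ← conj_baseChange, h]

end StrictSub

end BifilteredLattice

/-! ### Complex tori and Riemann forms -/

section Transport

variable {V V' : Type*} [AddCommGroup V] [Module ℂ V] [AddCommGroup V'] [Module ℂ V']

theorem IsComplexTorus.of_equiv {Λ : Submodule ℤ V} {Λ' : Submodule ℤ V'} (h : IsComplexTorus Λ)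
    (e : V ≃ₗ[ℂ] V') (he : ∀ v, e v ∈ Λ' ↔ v ∈ Λ) : IsComplexTorus Λ' := by
  obtain ⟨n, b, rfl⟩ := h
  refine ⟨n, b.map (e.restrictScalars ℝ), ?_⟩
  have hr : Set.range (b.map (e.restrictScalars ℝ)) =
      (e.toLinearMap.restrictScalars ℤ) '' Set.range b := by
    rw [← Set.range_comp]
    rfl
  rw [hr, ← Submodule.map_span]
  ext w
  obtain ⟨v, rfl⟩ := e.surjective w
  rw [he]
  refine ⟨fun hv => ⟨v, hv, rfl⟩, ?_⟩
  rintro ⟨v', hv', h⟩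
  rwa [← e.injective h]

theorem IsAbelianVariety.of_equiv {Λ : Submodule ℤ V} {Λ' : Submodule ℤ V'}
    (h : IsAbelianVariety Λ) (e : V ≃ₗ[ℂ] V') (he : ∀ v, e v ∈ Λ' ↔ v ∈ Λ) :
    IsAbelianVariety Λ' := by
  obtain ⟨ht, E, h1, h2, h3, h4⟩ := h
  have hs : ∀ v ∈ Λ', e.symm v ∈ Λ := fun v hv => (he _).1 (by rwa [e.apply_symm_apply])
  refine ⟨ht.of_equiv e he, E.compl₁₂ (e.symm.toLinearMap.restrictScalars ℝ)
    (e.symm.toLinearMap.restrictScalars ℝ), fun v => h1 _,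
    fun x hx y hy => h2 _ (hs x hx) _ (hs y hy), fun v w => ?_, fun v hv => ?_⟩
  · change E (e.symm _) (e.symm _) = E (e.symm v) (e.symm w)
    rw [e.symm.map_smul, e.symm.map_smul, h3]
  · change 0 < E (e.symm _) (e.symm v)
    rw [e.symm.map_smul]
    exact h4 _ (by simpa using hv)

theorem IsAbelianVariety.isSemiabelian {Λ : Submodule ℤ V} (h : IsAbelianVariety Λ) :
    IsSemiabelian Λ := by
  refine ⟨⊥, ⟨0, Module.Basis.empty _, ?_⟩, ?_⟩
  · exact Subsingleton.elim _ _
  · refine h.of_equiv (Submodule.quotEquivOfEqBot ⊥ rfl).symm fun v => ?_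
    constructor
    · rintro ⟨w, hw, hwv⟩
      have : (Submodule.quotEquivOfEqBot (⊥ : Submodule ℂ V) rfl).symm w =
        (Submodule.quotEquivOfEqBot (⊥ : Submodule ℂ V) rfl).symm v := hwv
      rwa [← (LinearEquiv.injective _ this)]
    · exact fun hv => ⟨v, hv, rfl⟩

/-- Induction on the tangent space of a subtorus, as the real span of its lattice points. -/
theorem IsComplexTorus.induction {Λ : Submodule ℤ V} {U : Submodule ℂ V}
    (h : IsComplexTorus (Λ.comap (U.subtype.restrictScalars ℤ))) {C : V → Prop}
    (lattice : ∀ x ∈ U, x ∈ Λ → C x) (zero : C 0) (add : ∀ x y, C x → C y → C (x + y))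
    (smul : ∀ (r : ℝ) x, C x → C ((r : ℂ) • x)) {w : V} (hw : w ∈ U) : C w := by
  obtain ⟨n, b, hb⟩ := h
  have key : ∀ u : U, C u := by
    intro u
    induction b.mem_span u using Submodule.span_induction with
    | mem u h =>
      obtain ⟨i, rfl⟩ := h
      have h3 : b i ∈ Submodule.span ℤ (Set.range b) := Submodule.subset_span ⟨i, rfl⟩
      rw [← hb] at h3
      exact lattice _ (b i).2 h3
    | zero => exact zero
    | add x y _ _ hx hy => exact add _ _ hx hy
    | smul r x _ hx =>
      rw [← Complex.coe_smul]
      exact smul r _ hx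
  exact key ⟨w, hw⟩

end Transport

section RealForm

variable {N : Type*} [AddCommGroup N] [Module.Finite ℤ N] [Module.Free ℤ N]
  {V : Type*} [AddCommGroup V] [Module ℂ V] {π : ℂ ⊗[ℤ] N →ₗ[ℂ] V}

/-- For `F = ker π`: if `N_ℂ = F ⊕ F̄`, then `N_ℝ → N_ℂ / F` is an isomorphism of real vector
spaces, so that the image of `N` is a lattice. -/
theorem isComplexTorus_of_isCompl (hπ : Function.Surjective π)
    (h : IsCompl (LinearMap.ker π) (conjSub (LinearMap.ker π))) :
    IsComplexTorus (LinearMap.range ((π.restrictScalars ℤ).comp (TensorProduct.mk ℤ ℂ N 1))) := by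
  classical
  let b := Module.finBasis ℤ N
  let bC := b.baseChange ℂ
  have hbC : ∀ i, bC i = (1 : ℂ) ⊗ₜ[ℤ] b i := fun i => by simp [bC]
  let v : Fin (Module.finrank ℤ N) → V := fun i => π ((1 : ℂ) ⊗ₜ[ℤ] b i)
  have hconj : ∀ c : Fin (Module.finrank ℤ N) → ℂ,
      conj N (∑ i, c i • bC i) = ∑ i, (starRingEnd ℂ (c i)) • bC i := by
    intro c
    rw [map_sum]
    refine Finset.sum_congr rfl fun i _ => ?_
    rw [conj_smul, hbC, conj_one_tmul]
  have hv : ∀ r : Fin (Module.finrank ℤ N) → ℝ,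
      π (∑ i, (r i : ℂ) • bC i) = ∑ i, r i • v i := by
    intro r
    rw [map_sum]
    refine Finset.sum_congr rfl fun i _ => ?_
    rw [map_smul, hbC, Complex.coe_smul]
  have hli : LinearIndependent ℝ v := by
    rw [Fintype.linearIndependent_iff]
    intro r hr i
    rw [← hv] at hr
    have hreal : conj N (∑ i, (r i : ℂ) • bC i) = ∑ i, (r i : ℂ) • bC i := by
      rw [hconj]
      simp
    have h0 := Submodule.disjoint_def.1 h.disjoint (∑ i, (r i : ℂ) • bC i) hr
      (by rw [mem_conjSub, hreal]; exact hr)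
    have := Fintype.linearIndependent_iff.1 bC.linearIndependent _ h0 i
    exact_mod_cast this
  have hsp : ⊤ ≤ Submodule.span ℝ (Set.range v) := by
    intro w _
    obtain ⟨x, rfl⟩ := hπ w
    have hx : x ∈ LinearMap.ker π ⊔ conjSub (LinearMap.ker π) := by
      rw [h.sup_eq_top]
      trivial
    obtain ⟨f, hf, g, hg, rfl⟩ := Submodule.mem_sup.1 hx
    have hg' : π (conj N g) = 0 := hg
    have hy : π (f + g) = π (g + conj N g) := by
      rw [map_add, map_add, hg', LinearMap.mem_ker.1 hf, zero_add, add_zero]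
    have hyr : conj N (g + conj N g) = g + conj N g := by
      rw [map_add, conj_conj, add_comm]
    have hsum := bC.sum_repr (g + conj N g)
    have hre : ∀ i, ((bC.repr (g + conj N g) i).re : ℂ) = bC.repr (g + conj N g) i := by
      intro i
      rw [← Complex.conj_eq_iff_re]
      have h1 := hconj (fun i => bC.repr (g + conj N g) i)
      rw [hsum, hyr] at h1
      have h2 := congrArg (fun z => bC.repr z i) h1
      simp only [bC.repr_sum_self] at h2
      exact h2.symm
    rw [hy, ← hsum]
    rw [show ∑ i, bC.repr (g + conj N g) i • bC i =
      ∑ i, ((bC.repr (g + conj N g) i).re : ℂ) • bC i from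
        Finset.sum_congr rfl fun i _ => by rw [hre i], hv fun i => (bC.repr (g + conj N g) i).re]
    exact Submodule.sum_mem _ fun i _ => Submodule.smul_mem _ _ (Submodule.subset_span ⟨i, rfl⟩)
  refine ⟨_, Module.Basis.mk hli hsp, ?_⟩
  rw [Module.Basis.coe_mk, LinearMap.range_eq_map, ← b.span_eq, Submodule.map_span,
    ← Set.range_comp]
  rfl

/-- A polarization `S` of a structure of level one gives the Riemann form
`E(v, w) = -2 Re S(σ v, conj (σ w))`, where `σ` is the section of `π` with values in the
conjugate of `F = ker π`; on the classes of real elements it is `-S`. -/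
theorem isAbelianVariety_of_polarization (hπ : Function.Surjective π)
    (h : IsCompl (LinearMap.ker π) (conjSub (LinearMap.ker π))) {S : LinearMap.BilinForm ℤ N}
    (hS : ∀ x y, S y x = -S x y)
    (hF : ∀ x ∈ LinearMap.ker π, ∀ y ∈ LinearMap.ker π,
      LinearMap.BilinForm.baseChange ℂ S x y = 0)
    (hpos : ∀ x ∈ conjSub (LinearMap.ker π), x ≠ 0 → ∃ t : ℝ, 0 < t ∧
      -Complex.I * LinearMap.BilinForm.baseChange ℂ S x (conj N x) = (t : ℂ)) :
    IsAbelianVariety (LinearMap.range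
      ((π.restrictScalars ℤ).comp (TensorProduct.mk ℤ ℂ N 1))) := by
  refine ⟨isComplexTorus_of_isCompl hπ h, ?_⟩
  obtain ⟨σ, hσ, hσπ⟩ : ∃ σ : V →ₗ[ℂ] ℂ ⊗[ℤ] N,
      (∀ v, σ v ∈ conjSub (LinearMap.ker π)) ∧ ∀ v, π (σ v) = v := by
    let e := Submodule.quotientEquivOfIsCompl _ _ h
    let q := π.quotKerEquivOfSurjective hπ
    refine ⟨(Submodule.subtype _).comp (e.toLinearMap.comp q.symm.toLinearMap),
      fun v => (e (q.symm v)).2, fun v => ?_⟩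
    change π (e (q.symm v)) = v
    have h1 : (LinearMap.ker π).mkQ (e (q.symm v) : ℂ ⊗[ℤ] N) = q.symm v :=
      Submodule.mk_quotientEquivOfIsCompl_apply h _
    have h2 : q ((LinearMap.ker π).mkQ (e (q.symm v) : ℂ ⊗[ℤ] N)) = π (e (q.symm v)) := rfl
    rw [← h2, h1, q.apply_symm_apply]
  set B := LinearMap.BilinForm.baseChange ℂ S with hB
  have hσr : ∀ (r : ℝ) v, σ (r • v) = (r : ℂ) • σ v := fun r v => by
    rw [← Complex.coe_smul, map_smul]
  have hswap : ∀ x y, B y x = -B x y := fun x y => by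
    rw [hB, baseChange_bilin_swap S (ε := -1) (fun x y => by rw [hS, neg_one_mul])]
    simp
  have hconj : ∀ x y, B (conj N x) y = starRingEnd ℂ (B x (conj N y)) := fun x y => by
    rw [hB, ← baseChange_bilin_conj, conj_conj]
  have hσ0 : ∀ v w, B (σ v) (σ w) = 0 := fun v w => by
    have h0 : B (conj N (σ v)) (conj N (σ w)) = 0 := hF _ (hσ v) _ (hσ w)
    rw [hconj, conj_conj] at h0
    simpa using h0
  have hσint : ∀ x : N, (1 : ℂ) ⊗ₜ[ℤ] x =
      σ (π ((1 : ℂ) ⊗ₜ[ℤ] x)) + conj N (σ (π ((1 : ℂ) ⊗ₜ[ℤ] x))) := fun x =>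
    eq_add_conj h.disjoint (conj_one_tmul x) (hσ _)
      (by rw [LinearMap.mem_ker, map_sub, hσπ, sub_self])
  refine ⟨LinearMap.mk₂ ℝ (fun v w => -2 * (B (σ v) (conj N (σ w))).re) ?_ ?_ ?_ ?_, ?_, ?_, ?_,
    ?_⟩
  · intro v v' w
    simp only [map_add, LinearMap.add_apply, Complex.add_re]
    ring
  · intro r v w
    simp only [hσr, map_smul, LinearMap.smul_apply, smul_eq_mul, Complex.re_ofReal_mul]
    ring
  · intro v w w'
    simp only [map_add, Complex.add_re]
    ring
  · intro r v w
    simp only [hσr, conj_smul, map_smul, smul_eq_mul, Complex.conj_ofReal,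
      Complex.re_ofReal_mul]
    ring
  · intro v
    rw [LinearMap.mk₂_apply]
    have h1 := hswap (σ v) (conj N (σ v))
    rw [hconj] at h1
    have h2 := congrArg Complex.re h1
    simp only [Complex.conj_re, Complex.neg_re] at h2
    linarith
  · rintro _ ⟨x, rfl⟩ _ ⟨y, rfl⟩
    refine ⟨-S x y, ?_⟩
    change -2 * (B (σ (π ((1 : ℂ) ⊗ₜ[ℤ] x))) (conj N (σ (π ((1 : ℂ) ⊗ₜ[ℤ] y))))).re =
      ((-S x y : ℤ) : ℝ)
    have h1 : B ((1 : ℂ) ⊗ₜ[ℤ] x) ((1 : ℂ) ⊗ₜ[ℤ] y) = (S x y : ℂ) := by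
      simp [hB]
    have h2 : B (conj N (σ (π ((1 : ℂ) ⊗ₜ[ℤ] x)))) (conj N (σ (π ((1 : ℂ) ⊗ₜ[ℤ] y)))) = 0 :=
      hF _ (hσ _) _ (hσ _)
    rw [hσint x, hσint y] at h1
    simp only [map_add, LinearMap.add_apply] at h1
    rw [h2, hσ0, hconj] at h1
    have h3 := congrArg Complex.re h1
    simp only [Complex.add_re, Complex.conj_re, Complex.zero_re, Complex.intCast_re] at h3
    push_cast
    linarith
  · intro v w
    rw [LinearMap.mk₂_apply, LinearMap.mk₂_apply]
    simp only [map_smul, conj_smul, LinearMap.smul_apply, smul_eq_mul, Complex.conj_I]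
    congr 2
    rw [← mul_assoc]
    simp
  · intro v hv
    rw [LinearMap.mk₂_apply]
    obtain ⟨t, ht, h1⟩ := hpos (σ v) (hσ v) fun h0 => hv (by rw [← hσπ v, h0, map_zero])
    have h2 : Complex.I * B (σ v) (conj N (σ v)) = ((-t : ℝ) : ℂ) := by
      push_cast
      rw [← h1]
      ring
    simp only [map_smul, LinearMap.smul_apply, smul_eq_mul]
    rw [h2, Complex.ofReal_re]
    linarith

end RealForm

namespace BifilteredLattice

variable {M N : Type*} [AddCommGroup M] [AddCommGroup N]

theorem isComplexTorus_latticeJ [Module.Finite ℤ N] [Module.Free ℤ N] (Y : BifilteredLattice N)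
    {p : ℤ} (hY : Y.IsOpposed (2 * p - 1)) : IsComplexTorus (Y.latticeJ p) :=
  isComplexTorus_of_isCompl (Submodule.mkQ_surjective _)
    (by rw [Submodule.ker_mkQ]; exact hY.isCompl_middle)

theorem isAbelianVariety_latticeJ [Module.Finite ℤ N] [Module.Free ℤ N]
    (Y : BifilteredLattice N) {p : ℤ} (hY : Y.IsOpposed (2 * p - 1))
    (hpol : Y.IsPolarizable (2 * p - 1)) (hlev : Y.IsLevelOne p) :
    IsAbelianVariety (Y.latticeJ p) := by
  obtain ⟨S, hS, hS1, hS2⟩ := hpol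
  have htop : Y.F (p - 1) = ⊤ := by
    rw [eq_top_iff, ← show _ = _ from hlev]
    exact sup_le inf_le_left (inf_le_left.trans (Y.F_anti (by omega)))
  refine isAbelianVariety_of_polarization (S := S) (Submodule.mkQ_surjective _) ?_ ?_ ?_ ?_
  · rw [Submodule.ker_mkQ]
    exact hY.isCompl_middle
  · intro x y
    rw [hS, Int.negOnePow_odd _ ⟨p - 1, by ring⟩]
    simp
  · rw [Submodule.ker_mkQ]
    intro x hx y hy
    exact hS1 p x hx y (by rwa [show 2 * p - 1 + 1 - p = p by ring])
  · rw [Submodule.ker_mkQ]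
    intro x hx hx0
    obtain ⟨t, ht, h⟩ := hS2 (p - 1) p (by ring) x ⟨by rw [htop]; trivial, hx⟩ hx0
    refine ⟨t, ht, ?_⟩
    rw [← h, show p - 1 - p = -1 by ring, zpow_neg_one, Complex.inv_I]

/-! ### The largest abelian subvariety of level one -/

section MaxSub

variable {X : BifilteredLattice M} {Y : BifilteredLattice N} {p : ℤ} {f : Hom X Y}

theorem tangentMap_injective (hF : ∀ k, X.F k = (Y.F k).comap (f.1.baseChange ℂ)) :
    Function.Injective (tangentMap p f) := by
  rw [← LinearMap.ker_eq_bot, eq_bot_iff]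
  intro v hv
  obtain ⟨m, rfl⟩ := Submodule.mkQ_surjective _ v
  have h1 : (Y.F p).mkQ (f.1.baseChange ℂ m) = 0 := hv
  rw [Submodule.mkQ_apply, Submodule.Quotient.mk_eq_zero] at h1
  rw [Submodule.mem_bot, Submodule.mkQ_apply, Submodule.Quotient.mk_eq_zero, hF]
  exact h1

/-- Because the largest level one sublattice is saturated, its tangent space meets the lattice
of `J^p` in nothing more than its own lattice. -/
theorem tangentMap_mem_latticeJ (hF : ∀ k, X.F k = (Y.F k).comap (f.1.baseChange ℂ))
    (hY : Y.IsOpposed (2 * p - 1)) (hmax : LinearMap.range f.1 = Y.maxLevelOneSub p)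
    (v : X.TangentJ p) : tangentMap p f v ∈ Y.latticeJ p ↔ v ∈ X.latticeJ p := by
  constructor
  · obtain ⟨m, rfl⟩ := Submodule.mkQ_surjective _ v
    rintro ⟨x, hx⟩
    have h1 : (Y.F p).mkQ ((1 : ℂ) ⊗ₜ[ℤ] x) = (Y.F p).mkQ (f.1.baseChange ℂ m) := hx
    rw [Submodule.mkQ_apply, Submodule.mkQ_apply, Submodule.Quotient.eq] at h1
    have h2 : x ∈ Y.maxLevelOneSub p := by
      refine mem_max_of_tmul_mem ((isLevelOneSub_max Y p).mem_baseChange_of_sub_mem hY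
        (conj_one_tmul x) (k := f.1.baseChange ℂ m) ?_ h1)
      rw [← hmax, ← range_baseChange]
      exact ⟨m, rfl⟩
    rw [← hmax] at h2
    obtain ⟨m', rfl⟩ := h2
    refine ⟨m', ?_⟩
    change (X.F p).mkQ ((1 : ℂ) ⊗ₜ[ℤ] m') = (X.F p).mkQ m
    rw [Submodule.mkQ_apply, Submodule.mkQ_apply, Submodule.Quotient.eq, hF, Submodule.mem_comap,
      map_sub, LinearMap.baseChange_tmul]
    exact h1
  · rintro ⟨m, rfl⟩
    refine ⟨f.1 m, ?_⟩
    change (Y.F p).mkQ ((1 : ℂ) ⊗ₜ[ℤ] f.1 m) =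
      (Y.F p).mkQ (f.1.baseChange ℂ ((1 : ℂ) ⊗ₜ[ℤ] m))
    rw [LinearMap.baseChange_tmul]

theorem mapJ_injective (hF : ∀ k, X.F k = (Y.F k).comap (f.1.baseChange ℂ))
    (hY : Y.IsOpposed (2 * p - 1)) (hmax : LinearMap.range f.1 = Y.maxLevelOneSub p) :
    Function.Injective (mapJ p f) := by
  rw [← LinearMap.ker_eq_bot, eq_bot_iff]
  intro v hv
  obtain ⟨m, rfl⟩ := Submodule.mkQ_surjective _ v
  have h1 : (Y.latticeJ p).mkQ (tangentMap p f m) = 0 := hv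
  rw [Submodule.mkQ_apply, Submodule.Quotient.mk_eq_zero,
    tangentMap_mem_latticeJ hF hY hmax] at h1
  rwa [Submodule.mem_bot, Submodule.mkQ_apply, Submodule.Quotient.mk_eq_zero]

theorem range_mapJ (f : Hom X Y) :
    LinearMap.range (mapJ p f) =
      ((LinearMap.range (tangentMap p f)).restrictScalars ℤ).map (Y.latticeJ p).mkQ := by
  ext w
  constructor
  · rintro ⟨v, rfl⟩
    obtain ⟨m, rfl⟩ := Submodule.mkQ_surjective _ v
    exact ⟨_, ⟨m, rfl⟩, rfl⟩
  · rintro ⟨_, ⟨m, rfl⟩, rfl⟩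
    exact ⟨(X.latticeJ p).mkQ m, rfl⟩

theorem isAbelianSubvariety_range_mapJ
    (hF : ∀ k, X.F k = (Y.F k).comap (f.1.baseChange ℂ))
    (hY : Y.IsOpposed (2 * p - 1)) (hmax : LinearMap.range f.1 = Y.maxLevelOneSub p)
    (hX : IsAbelianVariety (X.latticeJ p)) :
    IsAbelianSubvariety (Y.latticeJ p) (LinearMap.range (tangentMap p f))
      (LinearMap.range (mapJ p f)) :=
  ⟨hX.of_equiv (LinearEquiv.ofInjective _ (tangentMap_injective hF)) fun v =>
    tangentMap_mem_latticeJ hF hY hmax v, range_mapJ f⟩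

theorem range_tangentMap_le (hmax : LinearMap.range f.1 = Y.maxLevelOneSub p) :
    LinearMap.range (tangentMap p f) ≤ (Y.hodgePiece (p - 1) p).map (Y.F p).mkQ := by
  rintro _ ⟨v, rfl⟩
  obtain ⟨m, rfl⟩ := Submodule.mkQ_surjective _ v
  have h1 : f.1.baseChange ℂ m ∈ (Y.maxLevelOneSub p).baseChange ℂ := by
    rw [← hmax, ← range_baseChange]
    exact ⟨m, rfl⟩
  obtain ⟨u, hu, w, hw, huw⟩ := Submodule.mem_sup.1 (isLevelOneSub_max Y p h1)
  refine ⟨u, hu.2, ?_⟩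
  change (Y.F p).mkQ u = (Y.F p).mkQ (f.1.baseChange ℂ m)
  rw [← huw, map_add, Submodule.mkQ_apply _ w, (Submodule.Quotient.mk_eq_zero _).2 hw.2.1, add_zero]

/-- The integral elements whose class lies in the tangent space `U` of a subtorus form a level
one sublattice, if `U` is contained in the image of `H^{p-1,p}`. The point is that `U` is stable
under multiplication by `i` and is spanned over `ℝ` by these classes. -/
theorem isLevelOneSub_of_torus (hY : Y.IsOpposed (2 * p - 1)) {U : Submodule ℂ (Y.TangentJ p)}
    (hU : U ≤ (Y.hodgePiece (p - 1) p).map (Y.F p).mkQ)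
    (hT : IsComplexTorus ((Y.latticeJ p).comap (U.subtype.restrictScalars ℤ))) :
    Y.IsLevelOneSub p ((U.restrictScalars ℤ).comap
      (((Y.F p).mkQ.restrictScalars ℤ).comp (TensorProduct.mk ℤ ℂ N 1))) := by
  set P := (U.restrictScalars ℤ).comap
      (((Y.F p).mkQ.restrictScalars ℤ).comp (TensorProduct.mk ℤ ℂ N 1))
  -- every element of `U` is the class of a real element of `P_ℂ`
  have hreal : ∀ w ∈ U, ∃ y ∈ P.baseChange ℂ, conj N y = y ∧ (Y.F p).mkQ y = w := by
    intro w hw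
    refine hT.induction
      (C := fun w => ∃ y ∈ P.baseChange ℂ, conj N y = y ∧ (Y.F p).mkQ y = w) ?_
      ⟨0, Submodule.zero_mem _, map_zero _, map_zero _⟩ ?_ ?_ hw
    · rintro _ h ⟨x, rfl⟩
      exact ⟨(1 : ℂ) ⊗ₜ[ℤ] x, Submodule.tmul_mem_baseChange_of_mem _ h, conj_one_tmul x, rfl⟩
    · rintro _ _ ⟨y, hy, hy', rfl⟩ ⟨z, hz, hz', rfl⟩
      exact ⟨y + z, Submodule.add_mem _ hy hz, by rw [map_add, hy', hz'], map_add _ _ _⟩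
    · rintro r _ ⟨y, hy, hy', rfl⟩
      refine ⟨(r : ℂ) • y, Submodule.smul_mem _ _ hy, ?_, map_smul _ _ _⟩
      rw [conj_smul, hy', Complex.conj_ofReal]
  have hdisj := hY.isCompl_middle.disjoint
  refine isLevelOneSub_of_forall fun x hx => ?_
  have hxU : (Y.F p).mkQ ((1 : ℂ) ⊗ₜ[ℤ] x) ∈ U := hx
  obtain ⟨u, hu, hux⟩ := hU hxU
  have hxu : (1 : ℂ) ⊗ₜ[ℤ] x = u + conj N u := by
    refine eq_add_conj hdisj (conj_one_tmul x) hu.2 ?_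
    rw [← Submodule.Quotient.eq]
    exact hux.symm
  -- `y = i (u - ū)`, which together with `x = u + ū` isolates `u`
  obtain ⟨y, hy, hyr, hyu⟩ := hreal _ (U.smul_mem Complex.I hxU)
  have hyu' : y = Complex.I • u + conj N (Complex.I • u) := by
    refine eq_add_conj hdisj hyr (Submodule.smul_mem _ _ hu.2) ?_
    rw [← Submodule.Quotient.eq]
    change (Y.F p).mkQ y = (Y.F p).mkQ (Complex.I • u)
    rw [hyu, ← hux, map_smul]
  have hsum : u + conj N u ∈ P.baseChange ℂ := by
    rw [← hxu]
    exact Submodule.tmul_mem_baseChange_of_mem _ hx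
  have huP : u ∈ P.baseChange ℂ := by
    have h2 : u = (1 / 2 : ℂ) • (u + conj N u) - (Complex.I / 2) • y := by
      rw [hyu', conj_smul, Complex.conj_I]
      match_scalars
      · linear_combination (1 / 2 : ℂ) * Complex.I_sq
      · linear_combination (-1 / 2 : ℂ) * Complex.I_sq
    rw [h2]
    exact Submodule.sub_mem _ (Submodule.smul_mem _ _ hsum) (Submodule.smul_mem _ _ hy)
  rw [hxu]
  refine Submodule.add_mem_sup ⟨huP, hu⟩ ⟨conj_mem_baseChange P huP, hu.2, ?_⟩
  change conj N (conj N u) ∈ Y.F (p - 1)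
  rw [conj_conj]
  exact hu.1

theorem isGreatest_range_mapJ (hF : ∀ k, X.F k = (Y.F k).comap (f.1.baseChange ℂ))
    (hY : Y.IsOpposed (2 * p - 1)) (hmax : LinearMap.range f.1 = Y.maxLevelOneSub p)
    (hX : IsAbelianVariety (X.latticeJ p)) :
    IsGreatest {B : Submodule ℤ (Y.J p) | ∃ U ≤ (Y.hodgePiece (p - 1) p).map (Y.F p).mkQ,
      IsAbelianSubvariety (Y.latticeJ p) U B} (LinearMap.range (mapJ p f)) := by
  refine ⟨⟨_, range_tangentMap_le hmax, isAbelianSubvariety_range_mapJ hF hY hmax hX⟩, ?_⟩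
  rintro _ ⟨U, hU, ⟨hT, -⟩, rfl⟩
  have hP := (isLevelOneSub_of_torus hY hU hT).le_max
  rw [range_mapJ]
  refine Submodule.map_mono fun w hw => ?_
  change w ∈ LinearMap.range (tangentMap p f)
  refine hT.induction ?_ (Submodule.zero_mem _) (fun _ _ => Submodule.add_mem _)
    (fun r _ => Submodule.smul_mem _ (r : ℂ)) hw
  rintro _ hxU ⟨x, rfl⟩
  have hx : x ∈ Y.maxLevelOneSub p := hP hxU
  rw [← hmax] at hx
  obtain ⟨m, rfl⟩ := hx
  refine ⟨(X.F p).mkQ ((1 : ℂ) ⊗ₜ[ℤ] m), ?_⟩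
  change (Y.F p).mkQ (f.1.baseChange ℂ ((1 : ℂ) ⊗ₜ[ℤ] m)) = _
  rw [LinearMap.baseChange_tmul]
  rfl

end MaxSub

/-! ### Extension classes -/

section Extension

variable {L M N L' M' N' : Type*} [AddCommGroup L] [AddCommGroup M] [AddCommGroup N]
  [AddCommGroup L'] [AddCommGroup M'] [AddCommGroup N']

theorem toJ_eq_zero_iff (X : BifilteredLattice L) (p : ℤ) (a : ℂ ⊗[ℤ] L) :
    X.toJ p a = 0 ↔ ∃ x : L, a - (1 : ℂ) ⊗ₜ[ℤ] x ∈ X.F p := by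
  constructor
  · intro h
    change (X.latticeJ p).mkQ ((X.F p).mkQ a) = 0 at h
    rw [Submodule.mkQ_apply, Submodule.Quotient.mk_eq_zero] at h
    obtain ⟨x, hx⟩ := h
    exact ⟨x, (Submodule.Quotient.eq _).1 (Eq.symm hx)⟩
  · rintro ⟨x, hx⟩
    rw [← sub_add_cancel a ((1 : ℂ) ⊗ₜ[ℤ] x), map_add, toJ_of_mem_F _ _ hx, toJ_int, add_zero]

theorem toJ_surjective (X : BifilteredLattice L) (p : ℤ) : Function.Surjective (X.toJ p) := by
  intro w
  obtain ⟨v, rfl⟩ := Submodule.mkQ_surjective _ w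
  obtain ⟨x, rfl⟩ := Submodule.mkQ_surjective _ v
  exact ⟨x, rfl⟩

theorem mapJ_toJ {X : BifilteredLattice L} {Y : BifilteredLattice M} (p : ℤ) (f : Hom X Y)
    (a : ℂ ⊗[ℤ] L) : mapJ p f (X.toJ p a) = Y.toJ p (f.1.baseChange ℂ a) := rfl

theorem Hom.postcomp_apply (X : BifilteredLattice L) {Y : BifilteredLattice M}
    {Z : BifilteredLattice N} (g : Hom Y Z) (φ : Hom X Y) (x : L) :
    (Hom.postcomp X g φ).1 x = g.1 (φ.1 x) := rfl

/-- A morphism of extensions sends lifts to lifts. -/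
theorem ShortExact.IsLift.map {X : BifilteredLattice L} {Y : BifilteredLattice M}
    {Z : BifilteredLattice N} {X' : BifilteredLattice L'} {Y' : BifilteredLattice M'}
    {Z' : BifilteredLattice N'} {s : ShortExact X Y Z} {s' : ShortExact X' Y' Z'}
    {f : Hom X X'} {g : Hom Y Y'} {h : Hom Z Z'} (hi : g.1 ∘ₗ s.i.1 = s'.i.1 ∘ₗ f.1)
    (hq : h.1 ∘ₗ s.q.1 = s'.q.1 ∘ₗ g.1) {p : ℤ} {z : N} {y : M} {e : ℂ ⊗[ℤ] M}
    {a : ℂ ⊗[ℤ] L} (hl : s.IsLift p z y e a) :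
    s'.IsLift p (h.1 z) (g.1 y) (g.1.baseChange ℂ e) (f.1.baseChange ℂ a) := by
  obtain ⟨hy, he, hez, ha⟩ := hl
  refine ⟨?_, g.2.2 p e he, ?_, ?_⟩
  · rw [← hy]
    exact (LinearMap.congr_fun hq y).symm
  · rw [← LinearMap.comp_apply, ← LinearMap.baseChange_comp, ← hq, LinearMap.baseChange_comp,
      LinearMap.comp_apply, hez, LinearMap.baseChange_tmul]
  · rw [← LinearMap.comp_apply, ← LinearMap.baseChange_comp, ← hi, LinearMap.baseChange_comp,
      LinearMap.comp_apply, ha, map_sub, LinearMap.baseChange_tmul]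

/-- The class map is natural in the extension. -/
theorem ShortExact.mapJ_extClass {X : BifilteredLattice L} {Y : BifilteredLattice M}
    {Z : BifilteredLattice N} {X' : BifilteredLattice L'} {Y' : BifilteredLattice M'}
    {Z' : BifilteredLattice N'} (s : ShortExact X Y Z) (s' : ShortExact X' Y' Z')
    (f : Hom X X') (g : Hom Y Y') (h : Hom Z Z') (hi : g.1 ∘ₗ s.i.1 = s'.i.1 ∘ₗ f.1)
    (hq : h.1 ∘ₗ s.q.1 = s'.q.1 ∘ₗ g.1) (p : ℤ) (φ : Hom (tate p) Z) :
    mapJ p f (s.extClass p φ) = s'.extClass p (Hom.postcomp (tate p) h φ) := by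
  obtain ⟨y, e, a, hl⟩ := s.exists_isLift (Hom.tate_mem_F φ)
  rw [s.extClass_eq φ hl, mapJ_toJ]
  refine (s'.extClass_eq (Hom.postcomp (tate p) h φ) (y := g.1 y) (f := g.1.baseChange ℂ e) ?_).symm
  rw [Hom.postcomp_apply]
  exact hl.map hi hq

/-- The quotient of a structure of weight `2p - 1` by its largest level one sublattice has no
nonzero integral elements in `F^p`. -/
theorem ShortExact.eq_zero_of_mem_F {X : BifilteredLattice L} {Y : BifilteredLattice M}
    {Z : BifilteredLattice N} (s : ShortExact X Y Z) {p : ℤ} (hY : Y.IsOpposed (2 * p - 1))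
    (hmax : LinearMap.range s.i.1 = Y.maxLevelOneSub p) {z : N}
    (hz : (1 : ℂ) ⊗ₜ[ℤ] z ∈ Z.F p) : z = 0 := by
  obtain ⟨y, f, a, hy, hf, -, ha⟩ := s.exists_isLift hz
  have hk : -s.i.1.baseChange ℂ a ∈ (Y.maxLevelOneSub p).baseChange ℂ := by
    rw [← hmax, ← range_baseChange]
    exact Submodule.neg_mem _ ⟨a, rfl⟩
  have hy' : y ∈ Y.maxLevelOneSub p := by
    refine mem_max_of_tmul_mem ((isLevelOneSub_max Y p).mem_baseChange_of_sub_mem hY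
      (conj_one_tmul y) hk ?_)
    rwa [ha, sub_neg_eq_add, add_sub_cancel]
  rw [← hmax] at hy'
  rw [← hy]
  exact (s.exact y).2 hy'

theorem Hom.tate_ext {p : ℤ} {X : BifilteredLattice L} {φ ψ : Hom (tate p) X}
    (h : φ.1 1 = ψ.1 1) : φ = ψ :=
  Subtype.ext (LinearMap.ext_ring h)

/-- The morphism `ℤ(-p) ⟶ X` given by an integral element of `W_{2p} ∩ F^p`. -/
def Hom.ofTate {p : ℤ} {X : BifilteredLattice L} (t : L)
    (hW : (1 : ℚ) ⊗ₜ[ℤ] t ∈ X.W (2 * p)) (hF : (1 : ℂ) ⊗ₜ[ℤ] t ∈ X.F p) : Hom (tate p) X :=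
  ⟨LinearMap.toSpanSingleton ℤ L t, by
    have key : ∀ (R : Type) [CommRing R] (P : Submodule R (R ⊗[ℤ] L)), (1 : R) ⊗ₜ[ℤ] t ∈ P →
        ∀ x, (LinearMap.toSpanSingleton ℤ L t).baseChange R x ∈ P := by
      intro R _ P hP x
      induction x using TensorProduct.induction_on with
      | zero => simp
      | tmul c n =>
        have : c ⊗ₜ[ℤ] (n • t) = (n • c) • ((1 : R) ⊗ₜ[ℤ] t) := by
          rw [TensorProduct.smul_tmul', smul_eq_mul, mul_one, TensorProduct.smul_tmul]
        rw [LinearMap.baseChange_tmul, LinearMap.toSpanSingleton_apply, this]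
        exact P.smul_mem _ hP
      | add a b ha hb =>
        rw [map_add]
        exact P.add_mem ha hb
    refine ⟨fun k x hx => ?_, fun k x hx => ?_⟩
    · by_cases hk : 2 * p ≤ k
      · exact key ℚ _ (X.W_mono hk hW) x
      · have hx0 : x = 0 := by simpa [tate, hk] using hx
        rw [hx0, map_zero]
        exact Submodule.zero_mem _
    · by_cases hk : k ≤ p
      · exact key ℂ _ (X.F_anti hk hF) x
      · have hx0 : x = 0 := by simpa [tate, hk] using hx
        rw [hx0, map_zero]
        exact Submodule.zero_mem _⟩

theorem Hom.ofTate_one {p : ℤ} {X : BifilteredLattice L} (t : L)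
    (hW : (1 : ℚ) ⊗ₜ[ℤ] t ∈ X.W (2 * p)) (hF : (1 : ℂ) ⊗ₜ[ℤ] t ∈ X.F p) :
    (Hom.ofTate t hW hF).1 1 = t := by
  change (1 : ℤ) • t = t
  rw [one_smul]

end Extension

/-! ### Sublattices and sub-quotients -/

section Subquotients

variable {L : Type*} [AddCommGroup L]

/-- The preimage in `A` of a sublattice of `A / B`. -/
def preimageSub (A B : Submodule ℤ L) (P : Submodule ℤ (A ⧸ B.submoduleOf A)) : Submodule ℤ L :=
  (P.comap (B.submoduleOf A).mkQ).map A.subtype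

theorem preimageSub_le (A B : Submodule ℤ L) (P : Submodule ℤ (A ⧸ B.submoduleOf A)) :
    preimageSub A B P ≤ A :=
  Submodule.map_subtype_le _ _

theorem mem_preimageSub {A B : Submodule ℤ L} {P : Submodule ℤ (A ⧸ B.submoduleOf A)} (x : A) :
    x.1 ∈ preimageSub A B P ↔ (B.submoduleOf A).mkQ x ∈ P := by
  constructor
  · rintro ⟨y, hy, hyx⟩
    rw [← show y = x from Subtype.ext hyx]
    exact hy
  · exact fun h => ⟨x, h, rfl⟩

theorem le_preimageSub {A B : Submodule ℤ L} (hBA : B ≤ A)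
    (P : Submodule ℤ (A ⧸ B.submoduleOf A)) : B ≤ preimageSub A B P := by
  intro x hx
  refine (mem_preimageSub ⟨x, hBA hx⟩).2 ?_
  have h0 : (B.submoduleOf A).mkQ ⟨x, hBA hx⟩ = 0 := (Submodule.Quotient.mk_eq_zero _).2 hx
  rw [h0]
  exact Submodule.zero_mem _

theorem mkQ_mem_range_subquotLin {A B K : Submodule ℤ L} (hBK : B ≤ K) (hKA : K ≤ A) (x : A) :
    (B.submoduleOf A).mkQ x ∈ LinearMap.range (subquotLin hKA (le_refl B)) ↔ x.1 ∈ K := by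
  constructor
  · rintro ⟨y, hy⟩
    obtain ⟨k, rfl⟩ := Submodule.mkQ_surjective _ y
    have h1 : (B.submoduleOf A).mkQ (Submodule.inclusion hKA k) = (B.submoduleOf A).mkQ x := hy
    rw [Submodule.mkQ_apply, Submodule.mkQ_apply, Submodule.Quotient.eq] at h1
    have h2 : k.1 - x.1 ∈ K := hBK h1
    exact (Submodule.sub_mem_iff_right K k.2).1 h2
  · exact fun hx => ⟨(B.submoduleOf K).mkQ ⟨x.1, hx⟩, rfl⟩

theorem range_subquotLin_preimageSub {A B : Submodule ℤ L} (hBA : B ≤ A)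
    (P : Submodule ℤ (A ⧸ B.submoduleOf A)) (h : preimageSub A B P ≤ A) :
    LinearMap.range (subquotLin h (le_refl B)) = P := by
  ext w
  obtain ⟨x, rfl⟩ := Submodule.mkQ_surjective _ w
  rw [mkQ_mem_range_subquotLin (le_preimageSub hBA P), mem_preimageSub]

theorem subquotLin_injective (H : BifilteredLattice L) {B A C : Submodule ℤ L} (hBA : B ≤ A)
    (hAC : A ≤ C) : Function.Injective (subquotLin hAC (le_refl B)) :=
  (H.subquotExact hBA hAC).injective

theorem inducedStep_eq_top (H : BifilteredLattice L) {C : Submodule ℤ L} (B : Submodule ℤ L)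
    {k : ℤ} (hC : C ≤ H.WZ k) : inducedStep ℚ C B (H.W k) = ⊤ := by
  have h1 : (H.W k).comap (C.subtype.baseChange ℚ) = ⊤ := by
    rw [eq_top_iff]
    intro x _
    rw [Submodule.mem_comap]
    induction x using TensorProduct.induction_on with
    | zero => simp
    | tmul c y =>
      have h2 : c ⊗ₜ[ℤ] (y : L) = c • ((1 : ℚ) ⊗ₜ[ℤ] (y : L)) := by
        rw [TensorProduct.smul_tmul', smul_eq_mul, mul_one]
      rw [LinearMap.baseChange_tmul, Submodule.subtype_apply, h2]
      exact Submodule.smul_mem _ _ (hC y.2)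
    | add a b ha hb =>
      rw [map_add]
      exact Submodule.add_mem _ (ha trivial) (hb trivial)
  rw [inducedStep, h1, Submodule.map_top, LinearMap.range_eq_top, LinearMap.baseChange_eq_ltensor]
  exact LinearMap.lTensor_surjective ℚ (Submodule.mkQ_surjective _)

/-- The steps of the weight filtration are saturated in the lattice. -/
theorem mem_WZ_of_zsmul_mem (H : BifilteredLattice L) {k n : ℤ} (hn : n ≠ 0) {x : L}
    (hx : n • x ∈ H.WZ k) : x ∈ H.WZ k := by
  have h1 : (1 : ℚ) ⊗ₜ[ℤ] (n • x) ∈ H.W k := hx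
  have h2 : (1 : ℚ) ⊗ₜ[ℤ] x = (n : ℚ)⁻¹ • ((1 : ℚ) ⊗ₜ[ℤ] (n • x)) := by
    have h3 : (n : ℚ) ≠ 0 := by exact_mod_cast hn
    rw [← TensorProduct.smul_tmul, TensorProduct.smul_tmul', zsmul_eq_mul, mul_one, smul_eq_mul,
      inv_mul_cancel₀ h3]
  change (1 : ℚ) ⊗ₜ[ℤ] x ∈ H.W k
  rw [h2]
  exact Submodule.smul_mem _ _ h1

theorem free_quotient_WZ [Module.Finite ℤ L] (H : BifilteredLattice L) (k : ℤ)
    (C : Submodule ℤ L) : Module.Free ℤ (C ⧸ (H.WZ k).submoduleOf C) := by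
  have : Module.IsTorsionFree ℤ (C ⧸ (H.WZ k).submoduleOf C) := by
    refine Module.IsTorsionFree.of_smul_eq_zero fun n w h => ?_
    by_cases hn : n = 0
    · exact Or.inl hn
    · refine Or.inr ?_
      obtain ⟨x, rfl⟩ := Submodule.mkQ_surjective _ w
      rw [← map_smul, Submodule.mkQ_apply, Submodule.Quotient.mk_eq_zero] at h
      rw [Submodule.mkQ_apply, Submodule.Quotient.mk_eq_zero]
      exact H.mem_WZ_of_zsmul_mem hn h
  infer_instance

end Subquotients

/-! ### The sub-structure `H'` -/

section Hprime

variable {L : Type*} [AddCommGroup L] {H : BifilteredLattice L} {p : ℤ}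

theorem IsMHS.grOdd_isOpposed (hH : H.IsMHS) (p : ℤ) : (H.grOdd p).IsOpposed (2 * p - 1) := by
  have h := hH.opposed (2 * p - 1)
  unfold gr at h
  rwa [show 2 * p - 1 - 1 = 2 * p - 2 by ring] at h

theorem isLevelOneSub_of_mem_levelOneSubs {K : Submodule ℤ L} (hK : K ∈ H.levelOneSubs p) :
    (H.grOdd p).IsLevelOneSub p
      (LinearMap.range (subquotLin hK.2.1 (le_refl (H.WZ (2 * p - 2))))) :=
  isLevelOneSub_range (fun k => inducedStep_comap hK.1 hK.2.1 ℂ (H.F k)) hK.2.2.2.2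

theorem mem_levelOneSubs (hopp : (H.grOdd p).IsOpposed (2 * p - 1))
    (hpol : (H.grOdd p).IsPolarizable (2 * p - 1)) {K : Submodule ℤ L}
    (hBK : H.WZ (2 * p - 2) ≤ K) (hKA : K ≤ H.WZ (2 * p - 1))
    (hK : (H.grOdd p).IsLevelOneSub p
      (LinearMap.range (subquotLin hKA (le_refl (H.WZ (2 * p - 2)))))) :
    K ∈ H.levelOneSubs p := by
  have hF : ∀ k, (H.subquot K (H.WZ (2 * p - 2))).F k = ((H.grOdd p).F k).comap
      ((subquotLin hKA (le_refl (H.WZ (2 * p - 2)))).baseChange ℂ) :=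
    fun k => inducedStep_comap hBK hKA ℂ (H.F k)
  have hinj := H.subquotLin_injective hBK hKA
  have hlev := isLevelOne_of_range hinj hF hK
  exact ⟨hBK, hKA, isOpposed_of_isLevelOne hinj hF hopp hlev,
    isPolarizable_of_injective hinj hF hpol, hlev⟩

theorem preimageSub_max_isGreatest (hopp : (H.grOdd p).IsOpposed (2 * p - 1))
    (hpol : (H.grOdd p).IsPolarizable (2 * p - 1)) :
    IsGreatest (H.levelOneSubs p) (preimageSub (H.WZ (2 * p - 1)) (H.WZ (2 * p - 2))
      ((H.grOdd p).maxLevelOneSub p)) := by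
  refine ⟨mem_levelOneSubs hopp hpol (le_preimageSub (H.WZ_step₁ p) _) (preimageSub_le _ _ _) ?_,
    fun K hK x hx => ?_⟩
  · rw [range_subquotLin_preimageSub (H.WZ_step₁ p)]
    exact isLevelOneSub_max _ _
  · refine (mem_preimageSub ⟨x, hK.2.1 hx⟩).2 ((isLevelOneSub_of_mem_levelOneSubs hK).le_max ?_)
    exact (mkQ_mem_range_subquotLin hK.1 hK.2.1 ⟨x, hK.2.1 hx⟩).2 hx

theorem Hprime_eq_preimageSub (hopp : (H.grOdd p).IsOpposed (2 * p - 1))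
    (hpol : (H.grOdd p).IsPolarizable (2 * p - 1)) :
    H.Hprime p = preimageSub (H.WZ (2 * p - 1)) (H.WZ (2 * p - 2))
      ((H.grOdd p).maxLevelOneSub p) := by
  have h := preimageSub_max_isGreatest hopp hpol
  exact le_antisymm (sup_le (le_preimageSub (H.WZ_step₁ p) _) (sSup_le h.2))
    ((le_sSup h.1).trans le_sup_right)

theorem Hprime_isGreatest (hopp : (H.grOdd p).IsOpposed (2 * p - 1))
    (hpol : (H.grOdd p).IsPolarizable (2 * p - 1)) :
    IsGreatest (H.levelOneSubs p) (H.Hprime p) := by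
  rw [Hprime_eq_preimageSub hopp hpol]
  exact preimageSub_max_isGreatest hopp hpol

theorem range_Hprime (hopp : (H.grOdd p).IsOpposed (2 * p - 1))
    (hpol : (H.grOdd p).IsPolarizable (2 * p - 1)) :
    LinearMap.range (subquotLin (H.Hprime_le p) (le_refl (H.WZ (2 * p - 2)))) =
      (H.grOdd p).maxLevelOneSub p := by
  ext w
  obtain ⟨x, rfl⟩ := Submodule.mkQ_surjective _ w
  rw [mkQ_mem_range_subquotLin (H.WZ_le_Hprime p), Hprime_eq_preimageSub hopp hpol,
    mem_preimageSub]

theorem abelianPart_F (H : BifilteredLattice L) (p k : ℤ) :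
    (H.abelianPart p).F k = ((H.grOdd p).F k).comap
      ((H.subquotMap (H.Hprime_le p) (le_refl (H.WZ (2 * p - 2)))).1.baseChange ℂ) :=
  inducedStep_comap (H.WZ_le_Hprime p) (H.Hprime_le p) ℂ (H.F k)

theorem abelianPart_isAbelianVariety [Module.Finite ℤ L]
    (hopp : (H.grOdd p).IsOpposed (2 * p - 1))
    (hpol : (H.grOdd p).IsPolarizable (2 * p - 1)) :
    IsAbelianVariety ((H.abelianPart p).latticeJ p) := by
  obtain ⟨-, -, h1, h2, h3⟩ := (Hprime_isGreatest hopp hpol).1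
  have := H.free_quotient_WZ (2 * p - 2) (H.Hprime p)
  exact isAbelianVariety_latticeJ _ h1 h2 h3

/-! ### The restriction of `e^p` to `h^p` -/

theorem mem_Hsecond (H : BifilteredLattice L) (p : ℤ) (x : H.WZ (2 * p)) :
    x.1 ∈ H.Hsecond p ↔ (1 : ℂ) ⊗ₜ[ℤ] (((H.WZ (2 * p - 1)).submoduleOf (H.WZ (2 * p))).mkQ x) ∈
      (H.grEven p).F p := by
  constructor
  · rintro ⟨y, hy, hyx⟩
    rw [← show y = x from Subtype.ext hyx]
    exact hy
  · exact fun h => ⟨x, h, rfl⟩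

theorem cycleMap_injective (hopp : (H.grOdd p).IsOpposed (2 * p - 1))
    (hpol : (H.grOdd p).IsPolarizable (2 * p - 1)) : Function.Injective (H.cycleMap p) := by
  rw [← LinearMap.ker_eq_bot, eq_bot_iff]
  intro φ hφ
  rw [Submodule.mem_bot]
  refine Hom.tate_ext ?_
  change φ.1 1 = 0
  have h1 : (H.cycleMap p φ).1 1 = 0 := by
    rw [LinearMap.mem_ker.1 hφ]
    rfl
  have hF := Hom.tate_mem_F φ
  obtain ⟨y, hy⟩ := Submodule.mkQ_surjective _ (φ.1 1)
  have h2 : ((H.WZ (2 * p - 1)).submoduleOf (H.WZ (2 * p))).mkQ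
      (Submodule.inclusion (H.Hsecond_le p) y) = 0 := by
    refine Eq.trans ?_ h1
    change _ = subquotLin (H.Hsecond_le p) (H.Hprime_le p) (φ.1 1)
    rw [← hy]
    rfl
  rw [Submodule.mkQ_apply, Submodule.Quotient.mk_eq_zero] at h2
  -- `φ 1` is the class of `y ∈ W_{2p-1}`, so it comes from `W_{2p-1} / H'`
  let z : H.WZ (2 * p - 1) ⧸ (H.Hprime p).submoduleOf (H.WZ (2 * p - 1)) :=
    ((H.Hprime p).submoduleOf (H.WZ (2 * p - 1))).mkQ ⟨y.1, h2⟩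
  have hz : subquotLin (H.le_Hsecond p) (le_refl (H.Hprime p)) z = φ.1 1 := by
    rw [← hy]
    rfl
  have hzF : (1 : ℂ) ⊗ₜ[ℤ] z ∈ (H.subquot (H.WZ (2 * p - 1)) (H.Hprime p)).F p := by
    change _ ∈ inducedStep ℂ _ _ (H.F p)
    rw [inducedStep_comap (H.Hprime_le p) (H.le_Hsecond p), Submodule.mem_comap,
      LinearMap.baseChange_tmul, hz]
    exact hF
  have h3 := (H.subquotExact (H.WZ_le_Hprime p) (H.Hprime_le p)).eq_zero_of_mem_F hopp
    (range_Hprime hopp hpol) hzF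
  rw [← hz, h3, map_zero]

theorem jacobianMap_hMap (H : BifilteredLattice L) (p : ℤ) (φ : Hom (tate p) (H.cyclePart p)) :
    H.jacobianMap p (H.hMap p φ) = H.eMap p (H.cycleMap p φ) := by
  refine ShortExact.mapJ_extClass (H.subquotExact (H.WZ_le_Hprime p) (H.Hprime_le_Hsecond p))
    (H.subquotExact (H.WZ_step₁ p) (H.WZ_step₂ p))
    (H.subquotMap (H.Hprime_le p) le_rfl) (H.subquotMap (H.Hsecond_le p) le_rfl)
    (H.subquotMap (H.Hsecond_le p) (H.Hprime_le p)) ?_ ?_ p φ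
  · refine LinearMap.ext fun x => ?_
    obtain ⟨y, rfl⟩ := Submodule.mkQ_surjective _ x
    rfl
  · refine LinearMap.ext fun x => ?_
    obtain ⟨y, rfl⟩ := Submodule.mkQ_surjective _ x
    rfl

/-- If the class of `ψ` comes from `H'`, the Hodge lift and the integral lift of `ψ` can be chosen
to differ by an element of `H'_ℂ`, and the integral lift then defines a morphism to `H''/H'`. -/
theorem mem_range_cycleMap {ψ : Hom (tate p) (H.grEven p)}
    (hψ : H.eMap p ψ ∈ LinearMap.range (H.jacobianMap p)) :
    ψ ∈ LinearMap.range (H.cycleMap p) := by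
  let s := H.subquotExact (H.WZ_step₁ p) (H.WZ_step₂ p)
  let s' := H.subquotExact (H.WZ_le_Hprime p) (H.Hprime_le_Hsecond p)
  let j := H.subquotMap (H.Hprime_le p) (le_refl (H.WZ (2 * p - 2)))
  let m := H.subquotMap (H.Hsecond_le p) (le_refl (H.WZ (2 * p - 2)))
  have hmj : s.i.1 ∘ₗ j.1 = m.1 ∘ₗ s'.i.1 := by
    refine LinearMap.ext fun x => ?_
    obtain ⟨y, rfl⟩ := Submodule.mkQ_surjective _ x
    rfl
  obtain ⟨y, f, a, hy, hf, hfz, ha⟩ := s.exists_isLift (Hom.tate_mem_F ψ)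
  have he : H.eMap p ψ = (H.grOdd p).toJ p a := s.extClass_eq ψ ⟨hy, hf, hfz, ha⟩
  obtain ⟨w, hw⟩ := hψ
  obtain ⟨k, rfl⟩ := toJ_surjective _ _ w
  have hw' : (H.grOdd p).toJ p (j.1.baseChange ℂ k) = H.eMap p ψ := hw
  have h0 : (H.grOdd p).toJ p (a - j.1.baseChange ℂ k) = 0 := by
    rw [map_sub, hw', he, sub_self]
  obtain ⟨x, hx⟩ := (toJ_eq_zero_iff _ _ _).1 h0
  obtain ⟨l, hl⟩ := Submodule.mkQ_surjective _ (y + s.i.1 x)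
  have hlz : ((H.WZ (2 * p - 1)).submoduleOf (H.WZ (2 * p))).mkQ l = ψ.1 1 := by
    have h1 : s.q.1 (y + s.i.1 x) = ψ.1 1 := by
      rw [map_add, hy, (s.exact _).2 ⟨x, rfl⟩, add_zero]
    rw [← h1, ← hl]
    rfl
  have hlH : l.1 ∈ H.Hsecond p := by
    rw [mem_Hsecond, hlz]
    exact Hom.tate_mem_F ψ
  let y' : H.Hsecond p ⧸ (H.WZ (2 * p - 2)).submoduleOf (H.Hsecond p) :=
    ((H.WZ (2 * p - 2)).submoduleOf (H.Hsecond p)).mkQ ⟨l.1, hlH⟩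
  have hmy : m.1 y' = y + s.i.1 x := by
    rw [← hl]
    rfl
  let f' := (1 : ℂ) ⊗ₜ[ℤ] y' + s'.i.1.baseChange ℂ k
  have hmf : m.1.baseChange ℂ f' =
      f - s.i.1.baseChange ℂ (a - j.1.baseChange ℂ k - (1 : ℂ) ⊗ₜ[ℤ] x) := by
    have h2 : m.1.baseChange ℂ (s'.i.1.baseChange ℂ k) =
        s.i.1.baseChange ℂ (j.1.baseChange ℂ k) := by
      rw [← LinearMap.comp_apply, ← LinearMap.baseChange_comp, ← hmj, LinearMap.baseChange_comp,
        LinearMap.comp_apply]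
    rw [map_add, h2, LinearMap.baseChange_tmul, hmy, map_sub, map_sub, ha,
      LinearMap.baseChange_tmul, TensorProduct.tmul_add]
    abel
  have hf' : f' ∈ (H.subquot (H.Hsecond p) (H.WZ (2 * p - 2))).F p := by
    change f' ∈ inducedStep ℂ _ _ (H.F p)
    rw [inducedStep_comap ((H.WZ_le_Hprime p).trans (H.Hprime_le_Hsecond p)) (H.Hsecond_le p),
      Submodule.mem_comap]
    change m.1.baseChange ℂ f' ∈ (H.subquot (H.WZ (2 * p)) (H.WZ (2 * p - 2))).F p
    rw [hmf]
    exact Submodule.sub_mem _ hf (s.i.2.2 p _ hx)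
  have hqf : s'.q.1.baseChange ℂ f' = (1 : ℂ) ⊗ₜ[ℤ] s'.q.1 y' := by
    have h3 : s'.q.1.baseChange ℂ (s'.i.1.baseChange ℂ k) = 0 := by
      rw [← LinearMap.comp_apply, ← LinearMap.baseChange_comp, s'.exact.linearMap_comp_eq_zero,
        LinearMap.baseChange_zero, LinearMap.zero_apply]
    rw [map_add, h3, add_zero, LinearMap.baseChange_tmul]
  have htF : (1 : ℂ) ⊗ₜ[ℤ] s'.q.1 y' ∈ (H.cyclePart p).F p := by
    rw [← hqf]
    exact s'.q.2.2 p _ hf'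
  have htW : (1 : ℚ) ⊗ₜ[ℤ] s'.q.1 y' ∈ (H.cyclePart p).W (2 * p) := by
    change _ ∈ inducedStep ℚ _ _ (H.W (2 * p))
    rw [H.inducedStep_eq_top _ (H.Hsecond_le p)]
    trivial
  refine ⟨Hom.ofTate _ htW htF, Hom.tate_ext ?_⟩
  change subquotLin (H.Hsecond_le p) (H.Hprime_le p) ((Hom.ofTate _ htW htF).1 1) = ψ.1 1
  rw [Hom.ofTate_one, ← hlz]
  rfl

theorem range_cycleMap (H : BifilteredLattice L) (p : ℤ) :
    LinearMap.range (H.cycleMap p) = (LinearMap.range (H.jacobianMap p)).comap (H.eMap p) := by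
  refine le_antisymm ?_ fun ψ hψ => mem_range_cycleMap hψ
  rintro _ ⟨φ, rfl⟩
  exact ⟨H.hMap p φ, H.jacobianMap_hMap p φ⟩

theorem map_ker_hMap (hJ : Function.Injective (H.jacobianMap p)) :
    (LinearMap.ker (H.hMap p)).map (H.cycleMap p) = LinearMap.ker (H.eMap p) := by
  ext ψ
  constructor
  · rintro ⟨φ, hφ, rfl⟩
    rw [LinearMap.mem_ker, ← jacobianMap_hMap, LinearMap.mem_ker.1 hφ, map_zero]
  · intro hψ
    rw [LinearMap.mem_ker] at hψ
    have h1 : ψ ∈ LinearMap.range (H.cycleMap p) :=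
      mem_range_cycleMap (hψ ▸ Submodule.zero_mem _)
    obtain ⟨φ, rfl⟩ := h1
    refine ⟨φ, hJ ?_, rfl⟩
    rw [jacobianMap_hMap, hψ, map_zero]

theorem free_hom_tate_cyclePart [Module.Finite ℤ L]
    (hinj : Function.Injective (H.cycleMap p)) :
    Module.Free ℤ (Hom (tate p) (H.cyclePart p)) := by
  have := H.free_quotient_WZ (2 * p - 1) (H.WZ (2 * p))
  exact Module.Free.of_equiv (LinearEquiv.ofInjective _ hinj).symm

end Hprime

end BifilteredLattice

end HodgeOneMotive

end

theorem mainTheorem1 {L : Type*} [AddCommGroup L] [Module.Finite ℤ L] [IsAddTorsionFree L]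
    (H : HodgeOneMotive.BifilteredLattice L) (hH : H.IsMHS) (p : ℤ)
    (hpol : (H.grOdd p).IsPolarizable (2 * p - 1)) :
    -- `H'` is the largest sub-structure of the required kind
    IsGreatest (H.levelOneSubs p) (H.Hprime p) ∧
    -- `J^p(H)` is a complex torus
    HodgeOneMotive.IsComplexTorus ((H.grOdd p).latticeJ p) ∧
    -- `h^p` is a 1-motive over `ℂ`, whose semi-abelian part is an abelian variety
    HodgeOneMotive.IsOneMotive (H.hMap p) ∧
    HodgeOneMotive.IsAbelianVariety ((H.abelianPart p).latticeJ p) ∧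
    -- `Ext(ℤ(-p), H'/W_{2p-2})` embeds in `J^p(H)`, as the largest abelian subvariety among
    -- those with tangent space in `H^{p-1,p}`
    Function.Injective (H.jacobianMap p) ∧
    IsGreatest {B : Submodule ℤ ((H.grOdd p).J p) | ∃ U ≤ H.levelOneTangent p,
        HodgeOneMotive.IsAbelianSubvariety ((H.grOdd p).latticeJ p) U B}
      (LinearMap.range (H.jacobianMap p)) ∧
    -- `h^p` is the restriction of `e^p` to that abelian subvariety
    Function.Injective (H.cycleMap p) ∧
    LinearMap.range (H.cycleMap p) =
      (LinearMap.range (H.jacobianMap p)).comap (H.eMap p) ∧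
    (∀ φ, H.jacobianMap p (H.hMap p φ) = H.eMap p (H.cycleMap p φ)) ∧
    -- equality of kernels
    (LinearMap.ker (H.hMap p)).map (H.cycleMap p) = LinearMap.ker (H.eMap p) := by
  open HodgeOneMotive HodgeOneMotive.BifilteredLattice in
  have hopp := hH.grOdd_isOpposed p
  have hcyc := cycleMap_injective hopp hpol
  have hab := abelianPart_isAbelianVariety hopp hpol
  have hJ : Function.Injective (H.jacobianMap p) :=
    mapJ_injective (H.abelianPart_F p) hopp (range_Hprime hopp hpol)
  have := H.free_quotient_WZ (2 * p - 2) (H.WZ (2 * p - 1))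
  exact ⟨Hprime_isGreatest hopp hpol, isComplexTorus_latticeJ _ hopp,
    ⟨inferInstance, free_hom_tate_cyclePart hcyc, hab.isSemiabelian⟩, hab, hJ,
    isGreatest_range_mapJ (H.abelianPart_F p) hopp (range_Hprime hopp hpol) hab, hcyc,
    H.range_cycleMap p, H.jacobianMap_hMap p, map_ker_hMap hJ⟩
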